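/- Let $E$ be a real inner product space of finite dimension $N$, let $R\ge 0$, and let $B_R$ be the closed ball in $E$ with radius $R$ and the origin as center. Let $\mathcal D(B_R)$ be the space of smooth functions $f:E\to\mathbb C$ with support contained in $B_R$, with the Fréchet topology of uniform convergence of all derivatives. The orthogonal group $O(N)=O(E)$ acts on $\mathcal D(B_R)$ by $(g\cdot f)(x)=f(g^{-1}x)$; call $f\in\mathcal D(B_R)$ radial if $g\cdot f=f$ for all $g\in O(N)$, and $O(N)$-finite if the complex linear span of its orbit $\{g\cdot f: g\in O(N)\}$ is finite dimensional. For a complex-valued polynomial $p$ on $E$ let $\partial(p)$ be the corresponding constant coefficient differential operator, i.e. $p\mapsto\partial(p)$ is the homomorphism of unital complex algebras that sends the linear form $x\mapsto(\xi,x)$ to the directional derivative $\partial_\xi$, for every $\xi\in E$. Put $$\mathcal D_0(B_R)=\operatorname{Span}_{\mathbb C}\{\partial(p)f \mid p \text{ a polynomial on } E,\ f\in\mathcal D(B_R)\text{ radial}\}.$$ Then $\mathcal D_0(B_R)$ is exactly the set of $O(N)$-finite vectors in $\mathcal D(B_R)$. Moreover, $\mathcal D_0(B_R)$ is dense in $\mathcal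 D(B_R)$. -/

import Mathlib

open scoped Distributions

noncomputable section

namespace OrthogonalFinite

variable {E : Type*} [NormedAddCommGroup E] [InnerProductSpace ℝ E] [FiniteDimensional ℝ E]

/-- The closed ball `B_R` with radius `R` and the origin as center, as a compact set. -/
def ball (E : Type*) [NormedAddCommGroup E] [InnerProductSpace ℝ E] [FiniteDimensional ℝ E]
    (R : ℝ) : TopologicalSpace.Compacts E :=
  ⟨Metric.closedBall 0 R, isCompact_closedBall 0 R⟩

/-- The space `D(B_R)` of smooth complex-valued functions on `E` with support in `B_R`. It carries
the Fréchet topology of uniform convergence of all derivatives. -/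
abbrev Test (E : Type*) [NormedAddCommGroup E] [InnerProductSpace ℝ E] [FiniteDimensional ℝ E]
    (R : ℝ) : Type _ :=
  𝓓_{ball E R}(E, ℂ)

/-- The natural representation of the orthogonal group `O(E)` on `D(B_R)`:
`(g · f)(x) = f(g⁻¹ x)`. -/
def rotation (E : Type*) [NormedAddCommGroup E] [InnerProductSpace ℝ E] [FiniteDimensional ℝ E]
    (R : ℝ) : Representation ℂ (E ≃ₗᵢ[ℝ] E) (Test E R) where
  toFun g :=
    { toFun := fun f =>
        { toFun := fun x => f (g⁻¹ x)
          contDiff' := f.contDiff.comp (g⁻¹).toContinuousLinearEquiv.contDiff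
          zero_on_compl' := by
            intro x hx
            apply f.zero_on_compl
            intro h
            apply hx
            have h' : ‖g⁻¹ x‖ ≤ R := by
              have := h
              simpa [ball] using this
            rw [LinearIsometryEquiv.norm_map] at h'
            simpa [ball] using h' }
      map_add' := fun _ _ => rfl
      map_smul' := fun _ _ => rfl }
  map_one' := rfl
  map_mul' g h := by
    ext f x
    change f ((g * h)⁻¹ x) = f (h⁻¹ (g⁻¹ x))
    rw [mul_inv_rev]
    rfl

@[simp]
theorem rotation_apply {R : ℝ} (g : E ≃ₗᵢ[ℝ] E) (f : Test E R) (x : E) :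
    rotation E R g f x = f (g⁻¹ x) := rfl

/-- The (unnormalized) directional derivative `∂_ξ`, as a linear operator on `D(B_R)`. -/
def dirDeriv (R : ℝ) (ξ : E) : Module.End ℂ (Test E R) where
  toFun f :=
    { toFun := fun x => fderiv ℝ f x ξ
      contDiff' := (f.contDiff.fderiv_right (m := ((⊤ : ℕ∞) : WithTop ℕ∞)) le_rfl).clm_apply
        contDiff_const
      zero_on_compl' := by
        intro x hx
        have h : fderiv ℝ f x = 0 := by
          by_contra h
          exact hx (f.tsupport_subset (support_fderiv_subset ℝ h))
        simp [h] }
  map_add' f g := by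
    ext x
    have hf := (f.contDiff.differentiable (by simp)) x
    have hg := (g.contDiff.differentiable (by simp)) x
    change fderiv ℝ (fun y => f y + g y) x ξ = fderiv ℝ f x ξ + fderiv ℝ g x ξ
    rw [fderiv_fun_add hf hg]
    rfl
  map_smul' c f := by
    ext x
    have hf := (f.contDiff.differentiable (by simp)) x
    change fderiv ℝ (fun y => c • f y) x ξ = c • fderiv ℝ f x ξ
    rw [fderiv_fun_const_smul hf c]
    rfl

@[simp]
theorem dirDeriv_apply {R : ℝ} (ξ : E) (f : Test E R) (x : E) :
    dirDeriv R ξ f x = fderiv ℝ f x ξ := rfl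

theorem dirDeriv_comm (R : ℝ) (ξ η : E) :
    dirDeriv R ξ * dirDeriv R η = dirDeriv R η * dirDeriv R ξ := by
  ext f x
  have hf : ContDiff ℝ ((⊤ : ℕ∞) : WithTop ℕ∞) f := f.contDiff
  have hd : DifferentiableAt ℝ (fderiv ℝ f) x :=
    ((hf.fderiv_right (m := ((⊤ : ℕ∞) : WithTop ℕ∞)) le_rfl).differentiable (by simp)) x
  have key : ∀ v w : E,
      fderiv ℝ (fun y => fderiv ℝ f y w) x v = fderiv ℝ (fderiv ℝ f) x v w := by
    intro v w
    rw [fderiv_clm_apply hd (differentiableAt_const w)]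
    simp
  change fderiv ℝ (fun y => fderiv ℝ f y η) x ξ = fderiv ℝ (fun y => fderiv ℝ f y ξ) x η
  rw [key, key]
  exact (hf.contDiffAt.isSymmSndFDerivAt (by
    rw [minSmoothness_of_isRCLikeNormedField]
    exact WithTop.coe_le_coe.2 le_top)) ξ η

open scoped IsMulCommutative in
/-- The constant coefficient differential operator `∂(p)` on `D(B_R)`. The polynomials on `E` are
written in the coordinates `X i = ⟪b i, ·⟫` of an orthonormal basis `b`, and `p ↦ ∂(p)` is the
homomorphism of unital complex algebras with `∂(X i) = ∂_{b i}`; equivalently, it sends the linear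
form `⟪ξ, ·⟫` to `∂_ξ` for every `ξ` (see `polyDeriv_linear`). -/
def polyDeriv {N : ℕ} (b : OrthonormalBasis (Fin N) ℝ E) (R : ℝ) :
    MvPolynomial (Fin N) ℂ →ₐ[ℂ] Module.End ℂ (Test E R) :=
  haveI : IsMulCommutative (Algebra.adjoin ℂ (Set.range fun i => dirDeriv R (b i))) :=
    Algebra.isMulCommutative_adjoin ℂ (by
      rintro _ ⟨i, rfl⟩ _ ⟨j, rfl⟩
      exact dirDeriv_comm R (b i) (b j))
  (Algebra.adjoin ℂ (Set.range fun i => dirDeriv R (b i))).val.comp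
    (MvPolynomial.aeval (R := ℂ)
      (S₁ := Algebra.adjoin ℂ (Set.range fun i => dirDeriv R (b i))) fun i =>
        ⟨dirDeriv R (b i), Algebra.subset_adjoin (Set.mem_range_self i)⟩)

open scoped IsMulCommutative in
@[simp]
theorem polyDeriv_X {N : ℕ} (b : OrthonormalBasis (Fin N) ℝ E) (R : ℝ) (i : Fin N) :
    polyDeriv b R (MvPolynomial.X i) = dirDeriv R (b i) := by
  simp [polyDeriv]

theorem polyDeriv_linear {N : ℕ} (b : OrthonormalBasis (Fin N) ℝ E) (R : ℝ) (ξ : E) :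
    polyDeriv b R (∑ i, ((inner ℝ (b i) ξ : ℝ) : ℂ) • MvPolynomial.X i) = dirDeriv R ξ := by
  ext f x
  have h : ξ = ∑ i, (inner ℝ (b i) ξ : ℝ) • b i := (b.sum_repr' ξ).symm
  conv_rhs => rw [h]
  simp only [map_sum, map_smul, polyDeriv_X, dirDeriv_apply]
  induction (Finset.univ : Finset (Fin N)) using Finset.induction_on with
  | empty => simp
  | insert i s hi ih =>
    rw [Finset.sum_insert hi, Finset.sum_insert hi, ← ih]
    simp

/-- A function in `D(B_R)` is radial if it is invariant under the orthogonal group. -/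
def IsRadial {R : ℝ} (f : Test E R) : Prop :=
  ∀ g : E ≃ₗᵢ[ℝ] E, rotation E R g f = f

/-- The complex linear span `D_0(B_R)` of all functions `∂(p) f`, with `p` a polynomial and `f` a
radial function in `D(B_R)`. -/
def test0 {N : ℕ} (b : OrthonormalBasis (Fin N) ℝ E) (R : ℝ) : Submodule ℂ (Test E R) :=
  Submodule.span ℂ
    {h | ∃ (p : MvPolynomial (Fin N) ℂ) (f : Test E R), IsRadial f ∧ h = polyDeriv b R p f}

/-- A vector is finite for a representation of a group if its orbit spans a finite dimensional
subspace. -/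
def IsFiniteVector {G V : Type*} [Group G] [AddCommGroup V] [Module ℂ V]
    (ρ : Representation ℂ G V) (v : V) : Prop :=
  FiniteDimensional ℂ (Submodule.span ℂ (Set.range fun g => ρ g v))

end OrthogonalFinite

end

open scoped Distributions

noncomputable section

namespace OrthogonalFinite

/-! Everything rests on `mulLin_mem_test0`: $\mathcal D_0(B_R)$ is stable under multiplication by
linear forms, hence by polynomials. For radial $f=d(|x|)$ choose $p$ with $p'(r)=r\,d(r)$ and $p=0$
beyond $R$; then $\langle\xi,x\rangle f=\partial_\xi\,p(|x|)$ with $p(|x|)$ radial. Derivatives of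
radial functions follow from the commutator of $\langle\xi,\cdot\rangle$ and $\partial_\eta$, a
scalar.

Elements of $\mathcal D_0(B_R)$ are finite because radial functions are fixed and
$g\,\partial_\xi=\partial_{g\xi}\,g$. Conversely, let $V$ be the span of a finite orbit. The kernels
that represent point evaluations on $V$ for the $L^2$ pairing are zonal, i.e. fixed by the
stabilizer of a point, and they span $V$ (`mem_span_zonal`). A function zonal about a unit vector
$e$ is determined on a plane through $e$, where it is a finite sum of circle weights
(`exists_sum_weightComponent`). A smooth function of weight $n\ge0$ is $z^n d(|z|)$ with $d$ smooth
and even (`exists_even_of_weight`), and symmetrizing under conjugation leaves $d(|x|)(z^m+\bar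
z^m)$. A Chebyshev recursion puts these in $\mathcal D_0(B_R)$ (`exists_mem_test0_zonal`). If $E$ is
a line, even and odd parts replace the weights.

Density is proved directly: a dilation shrinks the support, convolution with a Landau kernel gives a
polynomial on $B_R$, and a radial cutoff times a polynomial lies in $\mathcal D_0(B_R)$. -/

open scoped ContDiff
open MeasureTheory

/-! ### Smooth even profiles, radial functions and circle weights -/

section OneVariable

open intervalIntegral

/-- The moment integral `∫₀¹ u ^ k g(r u) du`. -/
def moment (k : ℕ) (g : ℝ → ℂ) (r : ℝ) : ℂ :=
  ∫ u in (0 : ℝ)..1, (u : ℂ) ^ k * g (r * u)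

theorem hasDerivAt_moment (k : ℕ) {g : ℝ → ℂ} (hg : ContDiff ℝ 1 g) (r : ℝ) :
    HasDerivAt (moment k g) (moment (k + 1) (deriv g) r) r := by
  have hg' : Continuous (deriv g) := hg.continuous_deriv le_rfl
  obtain ⟨C, hC⟩ := (isCompact_closedBall (0 : ℝ) (|r| + 1)).exists_bound_of_continuousOn
    hg'.continuousOn
  have cont (k : ℕ) (h : ℝ → ℂ) (hh : Continuous h) (r : ℝ) :
      Continuous fun u : ℝ => (u : ℂ) ^ k * h (r * u) := by fun_prop
  refine (intervalIntegral.hasDerivAt_integral_of_dominated_loc_of_deriv_le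
    (bound := fun _ => C) (Metric.ball_mem_nhds r one_pos)
    (.of_forall fun x => (cont k g hg.continuous x).aestronglyMeasurable)
    ((cont k g hg.continuous r).intervalIntegrable _ _)
    (F' := fun x u => (u : ℂ) ^ (k + 1) * deriv g (x * u))
    (cont (k + 1) _ hg' r).aestronglyMeasurable
    (.of_forall fun u hu x hx => ?_) (by simp) (.of_forall fun u hu x hx => ?_)).2
  · rw [Set.uIoc_of_le zero_le_one] at hu
    have hu1 : |u| ≤ 1 := abs_le.2 ⟨by linarith [hu.1], hu.2⟩
    have hx' : |x| ≤ |r| + 1 := by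
      have h1 : |x - r| < 1 := by simpa [Real.dist_eq] using hx
      have h2 := abs_sub_abs_le_abs_sub x r
      linarith
    have h1 : ‖deriv g (x * u)‖ ≤ C := by
      apply hC
      simp only [mem_closedBall_zero_iff, Real.norm_eq_abs, abs_mul]
      nlinarith [abs_nonneg x, abs_nonneg u]
    rw [norm_mul, norm_pow, Complex.norm_real, Real.norm_eq_abs]
    calc |u| ^ (k + 1) * ‖deriv g (x * u)‖ ≤ 1 * C := by
          gcongr
          exact pow_le_one₀ (abs_nonneg u) hu1
      _ = C := one_mul C
  · have h1 : HasDerivAt g (deriv g (x * u)) (x * u) :=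
      (hg.differentiable one_ne_zero _).hasDerivAt
    have h2 : HasDerivAt (fun x : ℝ => x * u) u x := by simpa using (hasDerivAt_id x).mul_const u
    have h3 := (h1.scomp x h2).const_mul ((u : ℂ) ^ k)
    simp only [Function.comp_def, Complex.real_smul] at h3
    convert! h3 using 1
    ring

theorem contDiff_moment (k : ℕ) {g : ℝ → ℂ} (hg : ContDiff ℝ ∞ g) : ContDiff ℝ ∞ (moment k g) := by
  rw [contDiff_infty]
  intro n
  induction n generalizing k g with
  | zero =>
    exact contDiff_zero.2 (continuous_iff_continuousAt.2 fun r =>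
      (hasDerivAt_moment k (hg.of_le (by simp)) r).continuousAt)
  | succ n ih =>
    have hd : deriv (moment k g) = moment (k + 1) (deriv g) :=
      funext fun r => (hasDerivAt_moment k (hg.of_le (by simp)) r).deriv
    push_cast
    rw [contDiff_succ_iff_deriv]
    refine ⟨fun r => (hasDerivAt_moment k (hg.of_le (by simp)) r).differentiableAt, by simp, ?_⟩
    rw [hd]
    exact ih (k + 1) (contDiff_infty_iff_deriv.1 hg).2

theorem moment_even (k : ℕ) {g : ℝ → ℂ} (hg : g.Even) : (moment k g).Even := fun r => by
  simp only [moment, neg_mul, hg _]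

/-- Substitution $s=ru$. The moment is thus the primitive divided by $r^{k+1}$, in a form that stays
smooth at $r=0$. -/
theorem pow_mul_moment (k : ℕ) (g : ℝ → ℂ) (r : ℝ) :
    (r : ℂ) ^ (k + 1) * moment k g r = ∫ s in (0 : ℝ)..r, (s : ℂ) ^ k * g s := by
  have h := intervalIntegral.smul_integral_comp_mul_left (a := 0) (b := 1)
    (fun s : ℝ => (s : ℂ) ^ k * g s) r
  rw [mul_zero, mul_one] at h
  rw [← h, moment, Complex.real_smul, pow_succ', mul_assoc, ← intervalIntegral.integral_const_mul]
  congr 2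
  ext u
  push_cast
  ring

theorem deriv_even_of_odd {g : ℝ → ℂ} (hg : g.Odd) : (deriv g).Even := fun r => by
  have h : (fun x => g (-x)) = -g := funext hg
  have h2 := deriv_comp_neg g r
  rw [h, deriv.neg] at h2
  simpa using h2.symm

theorem deriv_odd_of_even {g : ℝ → ℂ} (hg : g.Even) : (deriv g).Odd := fun r => by
  have h : (fun x => g (-x)) = g := funext hg
  have h2 := deriv_comp_neg g r
  rw [h] at h2
  rw [h2, neg_neg]

/-- A smooth odd function is the product of the coordinate and a smooth even function. -/
theorem exists_even_of_odd {g : ℝ → ℂ} (hg : ContDiff ℝ ∞ g) (hodd : g.Odd) :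
    ∃ h : ℝ → ℂ, ContDiff ℝ ∞ h ∧ h.Even ∧ ∀ r : ℝ, g r = r * h r := by
  have hd := (contDiff_infty_iff_deriv.1 hg).2
  refine ⟨moment 0 (deriv g), contDiff_moment 0 hd, moment_even 0 (deriv_even_of_odd hodd),
    fun r => ?_⟩
  have h0 : g 0 = 0 := by
    have := hodd 0
    rw [neg_zero] at this
    exact self_eq_neg.1 this
  have h1 := pow_mul_moment 0 (deriv g) r
  simp only [zero_add, pow_one, pow_zero, one_mul] at h1
  rw [h1, intervalIntegral.integral_deriv_eq_sub
    (fun x _ => (hg.differentiable (by simp)) x) (hd.continuous.intervalIntegrable _ _), h0,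
    sub_zero]

/-- A smooth even function has an even primitive against `s ds`. -/
theorem exists_primitive {d : ℝ → ℂ} (hd : ContDiff ℝ ∞ d) (heven : d.Even) {R : ℝ}
    (hsupp : ∀ r, R < |r| → d r = 0) :
    ∃ e : ℝ → ℂ, ContDiff ℝ ∞ e ∧ e.Even ∧ (∀ r, R < |r| → e r = 0) ∧
      ∀ r : ℝ, HasDerivAt e (r * d r) r := by
  have hc : Continuous fun s : ℝ => (s : ℂ) * d s :=
    Complex.continuous_ofReal.mul hd.continuous
  -- The base point $|R|$ makes the primitive vanish beyond $R$; as the integrand is odd, the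
  -- primitive is even and vanishes on the other side too. The absolute value covers negative $R$.
  have hder (r : ℝ) : HasDerivAt (fun r => ∫ s in (|R|)..r, (s : ℂ) * d s) (r * d r) r :=
    integral_hasDerivAt_right (hc.intervalIntegrable _ _)
      hc.aestronglyMeasurable.stronglyMeasurableAtFilter hc.continuousAt
  have hev : Function.Even fun r : ℝ => ∫ s in (|R|)..r, (s : ℂ) * d s := fun r => by
    have h1 : ∫ s in (-r)..r, (s : ℂ) * d s = 0 := by
      have h2 := intervalIntegral.integral_comp_neg (a := -r) (b := r) fun s : ℝ => (s : ℂ) * d s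
      simp only [Complex.ofReal_neg, heven _, neg_mul, neg_neg,
        intervalIntegral.integral_neg] at h2
      exact self_eq_neg.1 h2.symm
    have h3 := integral_add_adjacent_intervals (hc.intervalIntegrable (μ := volume) (|R|) (-r))
      (hc.intervalIntegrable (-r) r)
    rw [h1, add_zero] at h3
    exact h3
  have hpos (r : ℝ) (hr : R < r) (hr0 : 0 ≤ r) : ∫ s in (|R|)..r, (s : ℂ) * d s = 0 := by
    apply intervalIntegral.integral_zero_ae
    have hR : ∀ᵐ s : ℝ, s ≠ |R| := by simp [ae_iff]
    filter_upwards [hR] with s hs hs'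
    have : R < |s| := by
      rcases le_total 0 R with h | h
      · rw [abs_of_nonneg h] at *
        rw [Set.uIoc_of_le hr.le] at hs'
        exact hs'.1.trans_le (le_abs_self s)
      · rcases h.lt_or_eq with h | h
        · exact h.trans_le (abs_nonneg s)
        · subst h
          simp only [abs_zero] at *
          exact abs_pos.2 hs
    rw [hsupp s this, mul_zero]
  refine ⟨fun r => ∫ s in (|R|)..r, (s : ℂ) * d s, ?_, hev, ?_, hder⟩
  · rw [contDiff_infty_iff_deriv]
    refine ⟨fun r => (hder r).differentiableAt, ?_⟩
    rw [funext fun r => (hder r).deriv]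
    exact Complex.ofRealCLM.contDiff.mul hd
  · intro r hr
    rcases le_total 0 r with h | h
    · exact hpos r (by rwa [abs_of_nonneg h] at hr) h
    · rw [← hev]
      exact hpos (-r) (by rwa [abs_of_nonpos h] at hr) (by linarith)

section Radial

variable {E : Type*} [NormedAddCommGroup E] [InnerProductSpace ℝ E]

/-- The factor $r$ in $e'(r)=r\,d(r)$ cancels the $|x|^{-1}$ in the gradient of the norm. At the
origin $e'(0)=0$ replaces the chain rule. -/
theorem hasFDerivAt_comp_norm {e d : ℝ → ℂ} (he : ∀ r : ℝ, HasDerivAt e (r * d r) r) (x : E) :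
    HasFDerivAt (fun x : E => e ‖x‖)
      ((innerSL ℝ x).smulRight (d ‖x‖)) x := by
  rcases eq_or_ne x 0 with rfl | hx
  · have h0 : HasDerivAt e 0 0 := by simpa using he 0
    rw [map_zero, ContinuousLinearMap.zero_smulRight]
    rw [hasDerivAt_iff_isLittleO] at h0
    refine .of_isLittleO ?_
    have ht : Filter.Tendsto (fun x : E => ‖x‖) (nhds 0) (nhds 0) := by
      simpa using (continuous_norm (E := E)).tendsto 0
    have h1 := h0.comp_tendsto ht
    simp only [sub_zero, smul_zero, Function.comp_def] at h1
    simpa using h1.of_norm_right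
  · have h1 : HasFDerivAt (fun x : E => ‖x‖) (‖x‖⁻¹ • innerSL ℝ x) x := by
      have h2 := (hasStrictFDerivAt_norm_sq x).hasFDerivAt.sqrt (by positivity)
      simp only [Real.sqrt_sq (norm_nonneg _)] at h2
      convert! h2 using 1
      ext y
      simp
      field_simp
    have h3 := (he ‖x‖).hasFDerivAt.comp x h1
    convert! h3 using 1
    ext y
    have : (‖x‖ : ℂ) ≠ 0 := by simpa using hx
    simp
    field_simp

/-- Since $d'$ is odd, $d'(r)=r\,h(r)$ with $h$ smooth and even, so the derivative at $x$ is
$h(|x|)\langle x,\cdot\rangle$, to which the induction applies. -/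
theorem contDiff_comp_norm {d : ℝ → ℂ} (hd : ContDiff ℝ ∞ d) (heven : d.Even) :
    ContDiff ℝ ∞ fun x : E => d ‖x‖ := by
  rw [contDiff_infty]
  intro n
  induction n generalizing d with
  | zero => exact contDiff_zero.2 (hd.continuous.comp continuous_norm)
  | succ n ih =>
    obtain ⟨h, hh, hhe, heq⟩ := exists_even_of_odd (contDiff_infty_iff_deriv.1 hd).2
      (deriv_odd_of_even heven)
    have hder (x : E) := hasFDerivAt_comp_norm (e := d) (d := h) (fun r => by
      rw [← heq]
      exact (hd.differentiable (by simp) r).hasDerivAt) x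
    push_cast
    rw [contDiff_succ_iff_fderiv]
    refine ⟨fun x => (hder x).differentiableAt, by simp, ?_⟩
    rw [funext fun x => (hder x).fderiv]
    exact (innerSL ℝ).contDiff.smulRight (ih hh hhe)

end Radial

/-- A smooth function on the plane that transforms by the `n`-th power under rotations is, on the
real axis, `r ^ n` times a smooth even function. -/
theorem exists_even_of_weight (n : ℕ) {F : ℂ → ℂ} (hF : ContDiff ℝ ∞ F)
    (hw : ∀ (u : Circle) (z : ℂ), F (u * z) = (u : ℂ) ^ n * F z) :
    ∃ d : ℝ → ℂ, ContDiff ℝ ∞ d ∧ d.Even ∧ ∀ r : ℝ, F r = (r : ℂ) ^ n * d r := by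
  induction n generalizing F with
  | zero =>
    refine ⟨fun r => F r, hF.comp Complex.ofRealCLM.contDiff, fun r => ?_, by simp⟩
    simpa using hw (-1) r
  | succ n ih =>
    have hdiff : Differentiable ℝ F := hF.differentiable (by simp)
    have hrot (u : Circle) (z w : ℂ) :
        fderiv ℝ F (u * z) (u * w) = (u : ℂ) ^ (n + 1) * fderiv ℝ F z w := by
      have h1 : HasFDerivAt (fun z : ℂ => F (u * z))
          ((fderiv ℝ F (u * z)).comp ((u : ℂ) • ContinuousLinearMap.id ℝ ℂ)) z :=
        (hdiff _).hasFDerivAt.comp z ((hasFDerivAt_id z).const_smul (u : ℂ))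
      have h2 : HasFDerivAt (fun z : ℂ => (u : ℂ) ^ (n + 1) * F z)
          ((u : ℂ) ^ (n + 1) • fderiv ℝ F z) z :=
        (hdiff z).hasFDerivAt.const_mul _
      rw [funext (hw u)] at h1
      simpa using DFunLike.congr_fun (h1.unique h2) w
    have hlin (z : ℂ) (a b : ℝ) : fderiv ℝ F z (a + b * Complex.I) =
        a * fderiv ℝ F z 1 + b * fderiv ℝ F z Complex.I := by
      have : (a + b * Complex.I : ℂ) = a • (1 : ℂ) + b • Complex.I := by simp
      rw [this, map_add, map_smul, map_smul, Complex.real_smul, Complex.real_smul]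
    have hfd : ContDiff ℝ ∞ (fderiv ℝ F) := hF.fderiv_right (by simp)
    -- The operator $\partial_x-i\partial_y$ lowers the weight by one.
    obtain ⟨g, hg, hge, hgeq⟩ := ih
      (F := fun z => fderiv ℝ F z 1 - Complex.I * fderiv ℝ F z Complex.I)
      ((hfd.clm_apply contDiff_const).sub (contDiff_const.mul (hfd.clm_apply contDiff_const)))
      (fun u z => by
        have hu : (u : ℂ) * (starRingEnd ℂ) u = 1 := by
          rw [Complex.mul_conj, Circle.normSq_coe, Complex.ofReal_one]
        have hc : (starRingEnd ℂ) (u : ℂ) =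
            ((u : ℂ).re : ℂ) + ((-(u : ℂ).im : ℝ) : ℂ) * Complex.I := by
          apply Complex.ext <;> simp
        have hc' : (starRingEnd ℂ) (u : ℂ) * Complex.I =
            ((u : ℂ).im : ℂ) + ((u : ℂ).re : ℂ) * Complex.I := by
          apply Complex.ext <;> simp
        have h1 := hrot u z ((starRingEnd ℂ) u)
        have h2 := hrot u z ((starRingEnd ℂ) u * Complex.I)
        rw [hu, hc, hlin] at h1
        rw [← mul_assoc, hu, one_mul, hc', hlin] at h2
        rw [h1, h2]
        have h3 : (u : ℂ) ^ n = (u : ℂ) ^ (n + 1) * (starRingEnd ℂ) u := by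
          rw [pow_succ, mul_assoc, hu, mul_one]
        rw [h3, hc]
        push_cast
        linear_combination (-(u : ℂ) ^ (n + 1) * (u : ℂ).im * fderiv ℝ F z Complex.I) *
          Complex.I_sq)
    set c : ℝ → ℂ := fun r => F r with hcdef
    have hcs : ContDiff ℝ ∞ c := hF.comp Complex.ofRealCLM.contDiff
    have hcd (r : ℝ) : HasDerivAt c (fderiv ℝ F r 1) r := by
      have := (hdiff (r : ℂ)).hasFDerivAt.comp_hasDerivAt r
        (Complex.ofRealCLM.hasDerivAt (x := r))
      simpa [Function.comp_def, hcdef] using this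
    -- Differentiating the weight condition along the circle at angle $0$ expresses $\partial_yF$ on
    -- the real axis through $F$, leaving an ODE for $c$ alone.
    have hang (r : ℝ) : r * fderiv ℝ F r Complex.I = Complex.I * (n + 1) * c r := by
      have h1 : HasDerivAt (fun t : ℝ => Complex.exp (t * Complex.I)) Complex.I 0 := by
        have := ((Complex.ofRealCLM.hasDerivAt (x := (0 : ℝ))).mul_const Complex.I).cexp
        simpa using this
      have h2 : HasDerivAt (fun t : ℝ => F (Complex.exp (t * Complex.I) * r))
          (fderiv ℝ F r (Complex.I * r)) 0 := by
        refine HasFDerivAt.comp_hasDerivAt (0 : ℝ) ?_ (h1.mul_const (r : ℂ))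
        simpa using (hdiff (r : ℂ)).hasFDerivAt
      have h3 : HasDerivAt (fun t : ℝ => Complex.exp (t * Complex.I) ^ (n + 1) * c r)
          ((n + 1) * Complex.I * c r) 0 := by
        simpa using ((h1.pow (n + 1)).mul_const (c r))
      have h4 : (fun t : ℝ => F (Complex.exp (t * Complex.I) * r)) =
          fun t : ℝ => Complex.exp (t * Complex.I) ^ (n + 1) * c r := by
        funext t
        simpa using hw (Circle.exp t) r
      rw [h4] at h2
      have h5 := h2.unique h3
      have h6 := hlin r 0 r
      simp only [Complex.ofReal_zero, zero_add, zero_mul] at h6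
      rw [← h6, mul_comm (r : ℂ), h5]
      ring
    have hode (r : ℝ) : r * deriv c r + (n + 1) * c r = (r : ℂ) ^ (n + 1) * g r := by
      rw [(hcd r).deriv, pow_succ', mul_assoc, ← hgeq r]
      linear_combination Complex.I * hang r + (n + 1) * c r * Complex.I_sq
    -- Multiplied by $r^n$, the ODE reads $(r^{n+1}c)'=r^{2n+1}g$. Integrating from $0$ gives
    -- $r^{n+1}c=r^{2n+2}$ times this moment.
    refine ⟨moment (2 * n + 1) g, contDiff_moment _ hg, moment_even _ hge, fun r => ?_⟩
    have hprim (s : ℝ) : HasDerivAt (fun s : ℝ => (s : ℂ) ^ (n + 1) * c s)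
        ((s : ℂ) ^ (2 * n + 1) * g s) s := by
      have h1 : HasDerivAt (fun s : ℝ => (s : ℂ) ^ (n + 1)) ((n + 1) * (s : ℂ) ^ n) s := by
        simpa using! (Complex.ofRealCLM.hasDerivAt (x := s)).pow (n + 1)
      convert! h1.mul (hcs.differentiable (by simp) s).hasDerivAt using 1
      linear_combination -(s : ℂ) ^ n * hode s
    have h1 := pow_mul_moment (2 * n + 1) g r
    have hgc : Continuous fun s : ℝ => (s : ℂ) ^ (2 * n + 1) * g s := by
      have := hg.continuous
      fun_prop
    rw [integral_eq_sub_of_hasDerivAt (fun s _ => hprim s) (hgc.intervalIntegrable _ _)] at h1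
    change c r = _
    rcases eq_or_ne r 0 with rfl | hr
    · have := hode 0
      have hn : (n + 1 : ℂ) ≠ 0 := by exact_mod_cast n.succ_ne_zero
      simpa [hn] using this
    · have hr' : (r : ℂ) ^ (n + 1) ≠ 0 := pow_ne_zero _ (by exact_mod_cast hr)
      apply mul_left_cancel₀ hr'
      simp only [Complex.ofReal_zero, ne_eq, n.succ_ne_zero, not_false_eq_true, zero_pow, zero_mul,
        sub_zero] at h1
      rw [← h1]
      ring

end OneVariable

/-! ### Stability properties of $\mathcal D_0(B_R)$, and finiteness of its elements -/

section DZero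

variable {E : Type*} [NormedAddCommGroup E] [InnerProductSpace ℝ E] [FiniteDimensional ℝ E]
  {N : ℕ} {R : ℝ}

theorem Test.apply_eq_zero (f : Test E R) {x : E} (hx : R < ‖x‖) : f x = 0 :=
  f.zero_on_compl (by simpa [ball] using hx)

theorem Test.differentiable (f : Test E R) : Differentiable ℝ f :=
  f.contDiff.differentiable (by simp)

/-- A smooth function that vanishes off the ball `B_R`, as an element of `D(B_R)`. -/
def Test.mk' (f : E → ℂ) (hf : ContDiff ℝ ∞ f) (h : ∀ x, R < ‖x‖ → f x = 0) : Test E R where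
  toFun := f
  contDiff' := hf
  zero_on_compl' x hx := h x (by simpa [ball] using hx)

/-- Multiplication by the linear form `⟪ξ, ·⟫`, as a linear operator on `D(B_R)`. -/
def mulLin (R : ℝ) (ξ : E) : Module.End ℂ (Test E R) where
  toFun f := Test.mk' (fun x => (inner ℝ ξ x : ℝ) * f x)
    ((Complex.ofRealCLM.contDiff.comp (innerSL ℝ ξ).contDiff).mul f.contDiff)
    (fun x hx => by rw [f.apply_eq_zero hx, mul_zero])
  map_add' f g := by
    ext x
    exact mul_add _ _ _
  map_smul' c f := by
    ext x
    exact mul_left_comm _ c _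

@[simp]
theorem mulLin_apply (ξ : E) (f : Test E R) (x : E) :
    mulLin R ξ f x = (inner ℝ ξ x : ℝ) * f x := rfl

theorem mulLin_dirDeriv (ξ η : E) (f : Test E R) :
    mulLin R ξ (dirDeriv R η f) =
      dirDeriv R η (mulLin R ξ f) - ((inner ℝ ξ η : ℝ) : ℂ) • f := by
  ext x
  have h1 : HasFDerivAt (fun x => ((inner ℝ ξ x : ℝ) : ℂ))
      (Complex.ofRealCLM.comp (innerSL ℝ ξ)) x :=
    (Complex.ofRealCLM.comp (innerSL ℝ ξ)).hasFDerivAt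
  have h2 : HasFDerivAt (mulLin R ξ f) _ x := h1.mul (f.differentiable x).hasFDerivAt
  change (inner ℝ ξ x : ℝ) * fderiv ℝ f x η =
    fderiv ℝ (mulLin R ξ f) x η - ((inner ℝ ξ η : ℝ) : ℂ) * f x
  rw [h2.fderiv]
  simp
  ring

theorem dirDeriv_sum_smul (b : OrthonormalBasis (Fin N) ℝ E) (ξ : E) (f : Test E R) :
    dirDeriv R ξ f = ∑ i, ((inner ℝ (b i) ξ : ℝ) : ℂ) • dirDeriv R (b i) f := by
  rw [← polyDeriv_linear b R ξ]
  simp only [map_sum, map_smul, polyDeriv_X, LinearMap.sum_apply, LinearMap.smul_apply]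

/-- The reflection in the hyperplane orthogonal to $x-y$ exchanges two vectors of equal norm. -/
theorem IsRadial.apply_eq {f : Test E R} (hf : IsRadial f) {x y : E} (h : ‖x‖ = ‖y‖) :
    f x = f y := by
  have h1 := DFunLike.congr_fun (hf (Submodule.reflection (Submodule.span ℝ {x - y})ᗮ)⁻¹) x
  rw [rotation_apply, inv_inv, Submodule.reflection_sub h] at h1
  exact h1.symm

theorem isRadial_of_apply_eq {f : Test E R} (h : ∀ x y : E, ‖x‖ = ‖y‖ → f x = f y) :
    IsRadial f := fun g => by
  ext x
  exact h _ _ (g⁻¹.norm_map x)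

theorem IsRadial.exists_even {f : Test E R} (hf : IsRadial f) {e : E} (he : ‖e‖ = 1) :
    ∃ d : ℝ → ℂ, ContDiff ℝ ∞ d ∧ d.Even ∧ (∀ r, R < |r| → d r = 0) ∧ ∀ x, f x = d ‖x‖ := by
  refine ⟨fun r => f (r • e), f.contDiff.comp (contDiff_id.smul contDiff_const), fun r => ?_,
    fun r hr => f.apply_eq_zero (by simpa [norm_smul, he] using hr), fun x => ?_⟩
  · exact hf.apply_eq (by simp [norm_smul])
  · exact hf.apply_eq (by simp [norm_smul, he])

/-- The radial function in `D(B_R)` with a given smooth even profile. -/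
def ofProfile (E : Type*) [NormedAddCommGroup E] [InnerProductSpace ℝ E] [FiniteDimensional ℝ E]
    {d : ℝ → ℂ} (hd : ContDiff ℝ ∞ d) (he : d.Even) (hs : ∀ r, R < |r| → d r = 0) : Test E R :=
  Test.mk' (fun x => d ‖x‖) (contDiff_comp_norm hd he) fun x hx => hs _ (by simpa using hx)

@[simp]
theorem ofProfile_apply {d : ℝ → ℂ} (hd : ContDiff ℝ ∞ d) (he : d.Even)
    (hs : ∀ r, R < |r| → d r = 0) (x : E) : ofProfile E hd he hs x = d ‖x‖ := rfl

theorem isRadial_ofProfile {d : ℝ → ℂ} (hd : ContDiff ℝ ∞ d) (he : d.Even)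
    (hs : ∀ r, R < |r| → d r = 0) : IsRadial (ofProfile E hd he hs) :=
  isRadial_of_apply_eq fun x y h => by simp [h]

/-- With $f=d(|x|)$ take $g=p(|x|)$, where $p'(r)=r\,d(r)$. One $g$ serves all directions $\xi$. -/
theorem IsRadial.exists_dirDeriv_eq {f : Test E R} (hf : IsRadial f) :
    ∃ g : Test E R, IsRadial g ∧ ∀ ξ, mulLin R ξ f = dirDeriv R ξ g := by
  rcases subsingleton_or_nontrivial E with hE | hE
  · exact ⟨f, hf, fun ξ => by ext x; simp [Subsingleton.elim ξ 0]⟩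
  · obtain ⟨e, he⟩ := exists_norm_eq E zero_le_one
    obtain ⟨d, hd, hde, hds, hfd⟩ := hf.exists_even he
    obtain ⟨p, hp, hpe, hps, hpd⟩ := exists_primitive hd hde hds
    refine ⟨ofProfile E hp hpe hps, isRadial_ofProfile _ _ _, fun ξ => ?_⟩
    ext x
    change _ = fderiv ℝ (fun x : E => p ‖x‖) x ξ
    rw [(hasFDerivAt_comp_norm hpd x).fderiv, mulLin_apply, hfd]
    simp [real_inner_comm]

theorem IsRadial.mem_test0 {f : Test E R} (hf : IsRadial f) (b : OrthonormalBasis (Fin N) ℝ E) :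
    f ∈ test0 b R :=
  Submodule.subset_span ⟨1, f, hf, by simp⟩

theorem dirDeriv_basis_mem_test0 (b : OrthonormalBasis (Fin N) ℝ E) (i : Fin N) {h : Test E R}
    (hh : h ∈ test0 b R) : dirDeriv R (b i) h ∈ test0 b R := by
  have : test0 b R ≤ (test0 b R).comap (dirDeriv R (b i)) := by
    refine Submodule.span_le.2 ?_
    rintro _ ⟨p, f, hf, rfl⟩
    exact Submodule.subset_span ⟨MvPolynomial.X i * p, f, hf, by simp⟩
  exact this hh

theorem dirDeriv_mem_test0 (b : OrthonormalBasis (Fin N) ℝ E) (ξ : E) {h : Test E R}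
    (hh : h ∈ test0 b R) : dirDeriv R ξ h ∈ test0 b R := by
  rw [dirDeriv_sum_smul b]
  exact sum_mem fun i _ => Submodule.smul_mem _ _ (dirDeriv_basis_mem_test0 b i hh)

/-- `D_0(B_R)` is contained in every space that contains the radial functions and is stable under
partial derivatives. -/
theorem test0_le (b : OrthonormalBasis (Fin N) ℝ E) {P : Submodule ℂ (Test E R)}
    (hrad : ∀ f, IsRadial f → f ∈ P) (hder : ∀ i, ∀ f ∈ P, dirDeriv R (b i) f ∈ P) :
    test0 b R ≤ P := by
  refine Submodule.span_le.2 ?_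
  rintro _ ⟨p, f, hf, rfl⟩
  induction p using MvPolynomial.induction_on with
  | C a =>
    rw [← MvPolynomial.algebraMap_eq, AlgHom.commutes, Module.algebraMap_end_apply]
    exact P.smul_mem a (hrad f hf)
  | add p q hp hq =>
    rw [map_add]
    exact P.add_mem hp hq
  | mul_X p i hp =>
    rw [mul_comm, map_mul, polyDeriv_X]
    exact hder i _ hp

/-- Induction over derivatives of radial functions. Moving the linear form past $\partial_i$ leaves
a multiple of the function itself, so the induction must also carry membership of that function. -/
theorem mulLin_mem_test0 (b : OrthonormalBasis (Fin N) ℝ E) (ξ : E) {h : Test E R}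
    (hh : h ∈ test0 b R) : mulLin R ξ h ∈ test0 b R := by
  have key : test0 b R ≤ test0 b R ⊓ (test0 b R).comap (mulLin R ξ) := by
    refine test0_le b (fun f hf => ⟨hf.mem_test0 b, ?_⟩) fun i f hf =>
      ⟨dirDeriv_basis_mem_test0 b i hf.1, ?_⟩
    · obtain ⟨g, hg, hfg⟩ := hf.exists_dirDeriv_eq
      change mulLin R ξ f ∈ test0 b R
      rw [hfg ξ]
      exact dirDeriv_mem_test0 b ξ (hg.mem_test0 b)
    · change mulLin R ξ (dirDeriv R (b i) f) ∈ test0 b R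
      rw [mulLin_dirDeriv]
      exact sub_mem (dirDeriv_basis_mem_test0 b i hf.2) (Submodule.smul_mem _ _ hf.1)
  exact (key hh).2

/-- The zonal functions `d(|x|) (z ^ m + conj z ^ m)`, where `z` is a complex number with modulus
`|x|` and real part `⟪e, x⟫`, belong to `D_0(B_R)`. -/
theorem exists_mem_test0_zonal (b : OrthonormalBasis (Fin N) ℝ E) (e : E) (m : ℕ) {d : ℝ → ℂ}
    (hd : ContDiff ℝ ∞ d) (he : d.Even) (hs : ∀ r, R < |r| → d r = 0) :
    ∃ h ∈ test0 b R, ∀ (x : E) (z : ℂ), z.re = inner ℝ e x → ‖z‖ = ‖x‖ →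
      h x = d ‖x‖ * (z ^ m + (starRingEnd ℂ) z ^ m) := by
  induction m using Nat.strong_induction_on generalizing d with
  | _ m ih =>
    match m, ih with
    | 0, _ =>
      refine ⟨(2 : ℂ) • ofProfile E hd he hs,
        Submodule.smul_mem _ _ ((isRadial_ofProfile hd he hs).mem_test0 b), fun x z _ _ => ?_⟩
      change (2 : ℂ) * d ‖x‖ = _
      ring
    | 1, _ =>
      refine ⟨(2 : ℂ) • mulLin R e (ofProfile E hd he hs), Submodule.smul_mem _ _
        (mulLin_mem_test0 b e ((isRadial_ofProfile hd he hs).mem_test0 b)), fun x z hz _ => ?_⟩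
      change (2 : ℂ) * ((inner ℝ e x : ℝ) * d ‖x‖) = _
      rw [pow_one, pow_one, Complex.add_conj, hz]
      push_cast
      ring
    -- Chebyshev recursion: $z^{m+2}+\bar z^{m+2}=(z+\bar z)(z^{m+1}+\bar z^{m+1})-z\bar z(z^m+\bar
    -- z^m)$. Here $z+\bar z=2\langle e,x\rangle$ is a linear form, and $z\bar z=|x|^2$ is absorbed
    -- into the profile.
    | m + 2, ih =>
      obtain ⟨h₁, hm₁, heq₁⟩ := ih (m + 1) (by omega) hd he hs
      obtain ⟨h₀, hm₀, heq₀⟩ := ih m (by omega) (d := fun r : ℝ => (r : ℂ) ^ 2 * d r)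
        ((Complex.ofRealCLM.contDiff.pow 2).mul hd) (fun r => by simp [he r])
        (fun r hr => by simp [hs r hr])
      refine ⟨(2 : ℂ) • mulLin R e h₁ - h₀,
        sub_mem (Submodule.smul_mem _ _ (mulLin_mem_test0 b e hm₁)) hm₀, fun x z hz hzx => ?_⟩
      change (2 : ℂ) * ((inner ℝ e x : ℝ) * h₁ x) - h₀ x = _
      rw [heq₁ x z hz hzx, heq₀ x z hz hzx]
      have h1 : z + (starRingEnd ℂ) z = 2 * (inner ℝ e x : ℝ) := by
        rw [Complex.add_conj, hz]
        push_cast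
        ring
      have h2 : z * (starRingEnd ℂ) z = (‖x‖ : ℂ) ^ 2 := by
        rw [Complex.mul_conj, Complex.normSq_eq_norm_sq, hzx]
        push_cast
        ring
      linear_combination (-d ‖x‖ * (z ^ (m + 1) + (starRingEnd ℂ) z ^ (m + 1))) * h1 +
        d ‖x‖ * (z ^ m + (starRingEnd ℂ) z ^ m) * h2

theorem rotation_dirDeriv (g : E ≃ₗᵢ[ℝ] E) (ξ : E) (f : Test E R) :
    rotation E R g (dirDeriv R ξ f) = dirDeriv R (g ξ) (rotation E R g f) := by
  ext x
  have h1 : HasFDerivAt (rotation E R g f)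
      ((fderiv ℝ f (g⁻¹ x)).comp (g⁻¹).toContinuousLinearEquiv.toContinuousLinearMap) x :=
    (f.differentiable (g⁻¹ x)).hasFDerivAt.comp x
      (g⁻¹).toContinuousLinearEquiv.toContinuousLinearMap.hasFDerivAt
  rw [rotation_apply, dirDeriv_apply, dirDeriv_apply, h1.fderiv]
  change _ = fderiv ℝ f (g⁻¹ x) (g⁻¹ (g ξ))
  congr 1
  exact (g.symm_apply_apply ξ).symm

theorem isFiniteVector_iff_exists {f : Test E R} :
    IsFiniteVector (rotation E R) f ↔
      ∃ V : Submodule ℂ (Test E R), FiniteDimensional ℂ V ∧ ∀ g, rotation E R g f ∈ V := by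
  refine ⟨fun h => ⟨_, h, fun g => Submodule.subset_span ⟨g, rfl⟩⟩, ?_⟩
  rintro ⟨V, hV, h⟩
  refine Submodule.finiteDimensional_of_le (S₂ := V) (Submodule.span_le.2 ?_)
  rintro _ ⟨g, rfl⟩
  exact h g

/-- The space of `O(E)`-finite vectors of `D(B_R)`. -/
def finiteVectors (E : Type*) [NormedAddCommGroup E] [InnerProductSpace ℝ E]
    [FiniteDimensional ℝ E] (R : ℝ) : Submodule ℂ (Test E R) where
  carrier := {f | IsFiniteVector (rotation E R) f}
  zero_mem' := isFiniteVector_iff_exists.2 ⟨⊥, inferInstance, fun g => by simp⟩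
  add_mem' {f₁ f₂} h₁ h₂ := by
    obtain ⟨V₁, hV₁, h₁⟩ := isFiniteVector_iff_exists.1 h₁
    obtain ⟨V₂, hV₂, h₂⟩ := isFiniteVector_iff_exists.1 h₂
    exact isFiniteVector_iff_exists.2 ⟨V₁ ⊔ V₂, inferInstance, fun g => by
      rw [map_add]
      exact Submodule.add_mem_sup (h₁ g) (h₂ g)⟩
  smul_mem' c f h := by
    obtain ⟨V, hV, h⟩ := isFiniteVector_iff_exists.1 h
    exact isFiniteVector_iff_exists.2 ⟨V, hV, fun g => by
      rw [map_smul]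
      exact V.smul_mem c (h g)⟩

/-- If the orbit of $f$ lies in $V$, equivariance puts the orbit of $\partial_if$ in
$\sum_j\partial_jV$. -/
theorem test0_le_finiteVectors (b : OrthonormalBasis (Fin N) ℝ E) :
    test0 b R ≤ finiteVectors E R := by
  refine test0_le b (fun f hf => ?_) fun i f hf => ?_
  · exact isFiniteVector_iff_exists.2 ⟨Submodule.span ℂ {f}, inferInstance, fun g => by
      rw [hf g]
      exact Submodule.mem_span_singleton_self f⟩
  · obtain ⟨V, hV, h⟩ := isFiniteVector_iff_exists.1 hf
    refine isFiniteVector_iff_exists.2 ⟨⨆ j, V.map (dirDeriv R (b j)), inferInstance,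
      fun g => ?_⟩
    rw [rotation_dirDeriv, dirDeriv_sum_smul b]
    exact sum_mem fun j _ => Submodule.smul_mem _ _
      (Submodule.mem_iSup_of_mem j (Submodule.mem_map_of_mem (h g)))

end DZero

/-! ### Landau kernels, seminorm estimates and polynomial multipliers -/

section Kernels

theorem one_sub_sq_nonneg {E : Type*} [SeminormedAddCommGroup E] {L : ℝ} (hL : 0 < L) {x : E}
    (hx : x ∈ Metric.closedBall 0 L) :
    0 ≤ 1 - (‖x‖ / L) ^ 2 := by
  have h1 : ‖x‖ / L ≤ 1 := (div_le_one hL).2 (by simpa using hx)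
  have h2 : 0 ≤ ‖x‖ / L := by positivity
  nlinarith

section Convolution

open scoped Convolution
open ContinuousLinearMap Filter Topology

variable {E : Type*} [NormedAddCommGroup E] [InnerProductSpace ℝ E] [FiniteDimensional ℝ E]
  [MeasurableSpace E] [BorelSpace E]
  {F : Type*} [NormedAddCommGroup F] [NormedSpace ℝ F]

theorem fderiv_convolution_lsmul {κ : E → ℝ} (hκ : LocallyIntegrable κ) {f : E → F}
    (hf : ContDiff ℝ 1 f) (hfc : HasCompactSupport f) :
    fderiv ℝ (κ ⋆[lsmul ℝ ℝ] f) = (κ ⋆[lsmul ℝ ℝ] fderiv ℝ f) := by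
  funext x
  rw [(hfc.hasFDerivAt_convolution_right (lsmul ℝ ℝ) hκ hf x).fderiv]
  rfl

/-- All derivatives fall on $f$, so a kernel that is merely locally integrable suffices. The
induction step commutes the currying isometry with the integral. -/
theorem iteratedFDeriv_convolution_lsmul {κ : E → ℝ} (hκ : LocallyIntegrable κ) {f : E → F}
    (hf : ContDiff ℝ ∞ f) (hfc : HasCompactSupport f) (i : ℕ) :
    iteratedFDeriv ℝ i (κ ⋆[lsmul ℝ ℝ] f) = (κ ⋆[lsmul ℝ ℝ] iteratedFDeriv ℝ i f) := by
  induction i with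
  | zero =>
    funext x
    simp only [iteratedFDeriv_zero_eq_comp, Function.comp_apply, convolution_lsmul]
    rw [← LinearIsometryEquiv.coe_toContinuousLinearEquiv,
      ← ContinuousLinearEquiv.integral_comp_comm]
    simp
  | succ i ih =>
    have hfi : ContDiff ℝ 1 (iteratedFDeriv ℝ i f) :=
      hf.iteratedFDeriv_right (m := 1) (by exact_mod_cast le_top)
    funext x
    rw [iteratedFDeriv_succ_eq_comp_left, ih,
      fderiv_convolution_lsmul hκ hfi (hfc.iteratedFDeriv i), iteratedFDeriv_succ_eq_comp_left]
    simp only [Function.comp_apply, convolution_lsmul]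
    have h := ContinuousLinearEquiv.integral_comp_comm (X := E) (μ := volume) (𝕜 := ℝ)
      (E := E →L[ℝ] E [×i]→L[ℝ] F) (F := E [×(i + 1)]→L[ℝ] F)
      (continuousMultilinearCurryLeftEquiv ℝ
        (fun _ : Fin (i + 1) => E) F).symm.toContinuousLinearEquiv
      fun t => κ t • fderiv ℝ (iteratedFDeriv ℝ i f) (x - t)
    refine h.symm.trans (integral_congr_ae (.of_forall fun t => ?_))
    exact map_smul (continuousMultilinearCurryLeftEquiv ℝ (fun _ : Fin (i + 1) => E) F).symm
      (κ t) (fderiv ℝ (iteratedFDeriv ℝ i f) (x - t))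

/-- The Landau kernel, a normalized power of `1 - (‖x‖ / L) ^ 2` on the ball of radius `L`. -/
def landau (E : Type*) [NormedAddCommGroup E] [InnerProductSpace ℝ E] [FiniteDimensional ℝ E]
    [MeasurableSpace E] [BorelSpace E] (L : ℝ) (k : ℕ) : E → ℝ :=
  (Metric.closedBall 0 L).indicator fun x =>
    (∫ y in Metric.closedBall (0 : E) L, (1 - (‖y‖ / L) ^ 2) ^ k)⁻¹ * (1 - (‖x‖ / L) ^ 2) ^ k

theorem tendsto_landau {L : ℝ} (hL : 0 < L) {g : E → ℝ} (hg : Continuous g) :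
    Tendsto (fun k => ∫ x, landau E L k x * g x) atTop (𝓝 (g 0)) := by
  have h := tendsto_setIntegral_pow_smul_of_unique_maximum_of_isCompact_of_continuousOn
    (μ := (volume : Measure E)) (isCompact_closedBall (0 : E) L)
    (c := fun x => 1 - (‖x‖ / L) ^ 2) (x₀ := 0) (by fun_prop)
    (fun y _ hy => by
      have : 0 < (‖y‖ / L) ^ 2 := by positivity
      simpa using this) (fun x hx => one_sub_sq_nonneg hL hx) (by simp)
    (by
      rw [interior_closedBall _ hL.ne']
      exact subset_closure (Metric.mem_ball_self hL)) hg.continuousOn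
  refine h.congr fun k => ?_
  rw [smul_eq_mul, ← integral_const_mul, ← integral_indicator Metric.isClosed_closedBall.measurableSet]
  congr 1 with x
  by_cases hx : x ∈ Metric.closedBall (0 : E) L
  · simp [landau, Set.indicator_of_mem hx, mul_assoc]
  · simp [landau, Set.indicator_of_notMem hx]

theorem landau_nonneg {L : ℝ} (hL : 0 < L) (k : ℕ) (x : E) : 0 ≤ landau E L k x := by
  refine Set.indicator_nonneg (fun x hx => mul_nonneg (inv_nonneg.2 ?_)
    (pow_nonneg (one_sub_sq_nonneg hL hx) k)) x
  exact setIntegral_nonneg Metric.isClosed_closedBall.measurableSet fun y hy =>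
    pow_nonneg (one_sub_sq_nonneg hL hy) k

theorem integrable_landau_mul (L : ℝ) (k : ℕ) {g : E → ℝ} (hg : Continuous g) :
    Integrable fun x => landau E L k x * g x := by
  have h : IntegrableOn (fun x : E => (∫ y in Metric.closedBall (0 : E) L,
      (1 - (‖y‖ / L) ^ 2) ^ k)⁻¹ * (1 - (‖x‖ / L) ^ 2) ^ k * g x) (Metric.closedBall 0 L) :=
    ContinuousOn.integrableOn_compact (isCompact_closedBall _ _) (by fun_prop)
  rw [← integrable_indicator_iff Metric.isClosed_closedBall.measurableSet] at h
  refine h.congr (.of_forall fun x => ?_)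
  by_cases hx : x ∈ Metric.closedBall (0 : E) L
  · simp [landau, Set.indicator_of_mem hx]
  · simp [landau, Set.indicator_of_notMem hx]

theorem integrable_landau (L : ℝ) (k : ℕ) : Integrable (landau E L k) := by
  simpa using integrable_landau_mul (E := E) L k (g := fun _ => 1) continuous_const

theorem integral_landau {L : ℝ} (hL : 0 < L) (k : ℕ) : ∫ x, landau E L k x = 1 := by
  have h : ∫ x, landau E L k x = (∫ y in Metric.closedBall (0 : E) L, (1 - (‖y‖ / L) ^ 2) ^ k)⁻¹ *
      ∫ y in Metric.closedBall (0 : E) L, (1 - (‖y‖ / L) ^ 2) ^ k := by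
    rw [← integral_const_mul, ← integral_indicator Metric.isClosed_closedBall.measurableSet]
    rfl
  rw [h]
  apply inv_mul_cancel₀
  have hpos : 0 < ∫ y in Metric.closedBall (0 : E) L, (1 - (‖y‖ / L) ^ 2) ^ k := by
    rw [setIntegral_pos_iff_support_of_nonneg_ae]
    · refine (Metric.measure_ball_pos volume (0 : E) hL).trans_le (measure_mono fun x hx => ?_)
      have hx' : ‖x‖ < L := by simpa using hx
      refine ⟨(pow_pos ?_ k).ne', Metric.ball_subset_closedBall hx⟩
      have h1 : ‖x‖ / L < 1 := (div_lt_one hL).2 hx'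
      have h2 : 0 ≤ ‖x‖ / L := by positivity
      nlinarith
    · exact (ae_restrict_iff' Metric.isClosed_closedBall.measurableSet).2 (.of_forall fun y hy =>
        pow_nonneg (one_sub_sq_nonneg hL hy) k)
    · exact ContinuousOn.integrableOn_compact (isCompact_closedBall _ _) (by fun_prop)
  exact hpos.ne'

/-- The kernel is nonnegative with mass one, so the difference averages $f(x-y)-f(x)$. The bound is
uniform in $x$ and tends to $0$ by `tendsto_landau`. -/
theorem norm_landau_convolution_sub_le [CompleteSpace F] {L : ℝ} (hL : 0 < L) (k : ℕ) {f : E → F}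
    {C : NNReal} (hf : LipschitzWith C f) (x : E) :
    ‖(landau E L k ⋆[lsmul ℝ ℝ] f : E → F) x - f x‖ ≤ C * ∫ y, landau E L k y * ‖y‖ := by
  have hint : Integrable fun y => landau E L k y • f (x - y) := by
    refine (integrable_landau_mul (E := E) L k (g := fun y => ‖f (x - y)‖)
      (hf.continuous.comp (by fun_prop)).norm).mono
      ((integrable_landau L k).aestronglyMeasurable.smul
        (hf.continuous.comp (by fun_prop : Continuous fun y => x - y)).aestronglyMeasurable)
      (.of_forall fun y => by simp [norm_smul])
  have h1 : f x = ∫ y, landau E L k y • f x := by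
    rw [integral_smul_const, integral_landau hL, one_smul]
  rw [convolution_lsmul]
  rw [h1, ← integral_sub hint ((integrable_landau L k).smul_const _), ← integral_const_mul]
  refine norm_integral_le_of_norm_le ((integrable_landau_mul L k continuous_norm).const_mul _)
    (.of_forall fun y => ?_)
  rw [← smul_sub, norm_smul, Real.norm_of_nonneg (landau_nonneg hL k y)]
  have h2 := hf.norm_sub_le (x - y) x
  rw [sub_sub_cancel_left, norm_neg] at h2
  calc landau E L k y * ‖f (x - y) - f x‖ ≤ landau E L k y * (C * ‖y‖) := by
        gcongr
        exact landau_nonneg hL k y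
    _ = C * (landau E L k y * ‖y‖) := by ring

end Convolution

variable {E : Type*} [NormedAddCommGroup E] [InnerProductSpace ℝ E] [FiniteDimensional ℝ E]
  {N : ℕ} {R : ℝ}

open Filter Topology

theorem tendsto_of_norm_iteratedFDeriv_le {ι : Type*} {l : Filter ι} {h : ι → Test E R}
    {f : Test E R} {B : ℕ → ι → ℝ} (hB : ∀ i, Tendsto (B i) l (𝓝 0))
    (hle : ∀ i k x, ‖x‖ ≤ R → ‖iteratedFDeriv ℝ i (fun x => h k x - f x) x‖ ≤ B i k) :
    Tendsto h l (𝓝 f) := by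
  rw [(ContDiffMapSupportedIn.withSeminorms ℂ E ℂ ⊤ (ball E R)).tendsto_nhds]
  intro i ε hε
  have h1 : Tendsto (fun k => |B i k|) l (𝓝 0) := by simpa using (hB i).abs
  filter_upwards [h1.eventually_lt_const hε] with k hk
  refine lt_of_le_of_lt ?_ hk
  rw [ContDiffMapSupportedIn.seminorm_top_le_iff ℂ (abs_nonneg _)]
  intro x hx
  exact (hle i k x (mem_closedBall_zero_iff.1 hx)).trans (le_abs_self _)

theorem exists_lipschitzWith_iteratedFDeriv (f : Test E R) (i : ℕ) :
    ∃ C, LipschitzWith C (iteratedFDeriv ℝ i f) :=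
  ContDiff.lipschitzWith_of_hasCompactSupport (𝕂 := ℝ) (n := 1)
    (f.hasCompactSupport.iteratedFDeriv i)
    (f.contDiff.iteratedFDeriv_right (m := 1) (by exact_mod_cast le_top)) one_ne_zero

theorem exists_bound_iteratedFDeriv (f : Test E R) (i : ℕ) :
    ∃ C, ∀ x, ‖iteratedFDeriv ℝ i f x‖ ≤ C :=
  (f.hasCompactSupport.iteratedFDeriv i).exists_bound_of_continuous
    (f.contDiff.continuous_iteratedFDeriv (by exact_mod_cast le_top))

/-- The functions that act on `D_0(B_R)` by multiplication. -/
def multipliers (b : OrthonormalBasis (Fin N) ℝ E) (R : ℝ) : Subalgebra ℂ (E → ℂ) where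
  carrier := {q | ∀ φ ∈ test0 b R, ∃ ψ ∈ test0 b R, ∀ x, ψ x = q x * φ x}
  mul_mem' {p q} hp hq φ hφ := by
    obtain ⟨ψ, hψ, h⟩ := hq φ hφ
    obtain ⟨ψ', hψ', h'⟩ := hp ψ hψ
    exact ⟨ψ', hψ', fun x => by rw [h', h, Pi.mul_apply, mul_assoc]⟩
  add_mem' {p q} hp hq φ hφ := by
    obtain ⟨ψ, hψ, h⟩ := hp φ hφ
    obtain ⟨ψ', hψ', h'⟩ := hq φ hφ
    refine ⟨ψ + ψ', add_mem hψ hψ', fun x => ?_⟩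
    change ψ x + ψ' x = _
    rw [h', h, Pi.add_apply, add_mul]
  algebraMap_mem' c φ hφ := ⟨c • φ, Submodule.smul_mem _ _ hφ, fun x => rfl⟩

theorem inner_mem_multipliers (b : OrthonormalBasis (Fin N) ℝ E) (ξ : E) :
    (fun x => ((inner ℝ ξ x : ℝ) : ℂ)) ∈ multipliers b R :=
  fun φ hφ => ⟨mulLin R ξ φ, mulLin_mem_test0 b ξ hφ, fun _ => rfl⟩

theorem norm_sq_mem_multipliers (b : OrthonormalBasis (Fin N) ℝ E) :
    (fun x => ((‖x‖ ^ 2 : ℝ) : ℂ)) ∈ multipliers b R := by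
  have h : (fun x => ((‖x‖ ^ 2 : ℝ) : ℂ)) =
      ∑ i, (fun x => ((inner ℝ (b i) x : ℝ) : ℂ)) ^ 2 := by
    funext x
    rw [← b.sum_sq_norm_inner_right x]
    simp
  rw [h]
  exact sum_mem fun i _ => pow_mem (inner_mem_multipliers b _) 2

/-- The integral is a polynomial in $x$. Each induction step expands one factor by
$|x-y|^2=|x|^2+|y|^2-2\sum_i x_iy_i$ and moves the powers of $y$ into $f$, which is why $f$ is
arbitrary. -/
theorem integral_landau_mem_multipliers [MeasurableSpace E] [BorelSpace E]
    (b : OrthonormalBasis (Fin N) ℝ E) (s : ℝ) (k : ℕ) {f : E → ℂ} (hf : Continuous f)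
    (hfc : HasCompactSupport f) :
    (fun x => ∫ y, ((1 - s * ‖x - y‖ ^ 2 : ℝ) : ℂ) ^ k * f y) ∈ multipliers b R := by
  induction k generalizing f with
  | zero =>
    simp only [pow_zero, one_mul]
    exact (multipliers b R).algebraMap_mem (∫ y, f y)
  | succ k ih =>
    have hint (x : E) {g : E → ℂ} (hg : Continuous g) (hgc : HasCompactSupport g) :
        Integrable fun y => ((1 - s * ‖x - y‖ ^ 2 : ℝ) : ℂ) ^ k * g y :=
      (by fun_prop : Continuous fun y => ((1 - s * ‖x - y‖ ^ 2 : ℝ) : ℂ) ^ k * g y)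
        |>.integrable_of_hasCompactSupport hgc.mul_left
    have hc (i : Fin N) : Continuous fun y => ((inner ℝ (b i) y : ℝ) : ℂ) * f y := by fun_prop
    have hn : Continuous fun y => ((‖y‖ ^ 2 : ℝ) : ℂ) * f y := by fun_prop
    have h : (fun x => ∫ y, ((1 - s * ‖x - y‖ ^ 2 : ℝ) : ℂ) ^ (k + 1) * f y) =
        (1 - (s : ℂ) • fun x => ((‖x‖ ^ 2 : ℝ) : ℂ)) *
            (fun x => ∫ y, ((1 - s * ‖x - y‖ ^ 2 : ℝ) : ℂ) ^ k * f y) +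
          (∑ i, (2 * s : ℂ) • ((fun x => ((inner ℝ (b i) x : ℝ) : ℂ)) * fun x =>
            ∫ y, ((1 - s * ‖x - y‖ ^ 2 : ℝ) : ℂ) ^ k * ((inner ℝ (b i) y : ℝ) * f y))) -
          (s : ℂ) • fun x => ∫ y, ((1 - s * ‖x - y‖ ^ 2 : ℝ) : ℂ) ^ k *
            ((‖y‖ ^ 2 : ℝ) * f y) := by
      funext x
      simp only [Pi.sub_apply, Pi.add_apply, Pi.mul_apply, Pi.smul_apply, Finset.sum_apply,
        smul_eq_mul, Pi.one_apply, ← integral_const_mul]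
      rw [← integral_finsetSum _ fun i _ => ((hint x (hc i) hfc.mul_left).const_mul _).const_mul _,
        ← integral_add, ← integral_sub]
      · congr 1 with y
        have h1 : ((‖x - y‖ ^ 2 : ℝ) : ℂ) = ((‖x‖ ^ 2 : ℝ) : ℂ) + ((‖y‖ ^ 2 : ℝ) : ℂ) -
            2 * ∑ i, ((inner ℝ (b i) x : ℝ) : ℂ) * ((inner ℝ (b i) y : ℝ) : ℂ) := by
          rw [norm_sub_sq_real, ← b.sum_inner_mul_inner x y]
          simp only [real_inner_comm]
          push_cast
          ring
        have h2 : ∑ i, 2 * (s : ℂ) * (((inner ℝ (b i) x : ℝ) : ℂ) *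
            (((1 - s * ‖x - y‖ ^ 2 : ℝ) : ℂ) ^ k * ((inner ℝ (b i) y : ℝ) * f y))) =
            2 * s * ((1 - s * ‖x - y‖ ^ 2 : ℝ) : ℂ) ^ k * f y *
              ∑ i, ((inner ℝ (b i) x : ℝ) : ℂ) * ((inner ℝ (b i) y : ℝ) : ℂ) := by
          rw [Finset.mul_sum]
          exact Finset.sum_congr rfl fun i _ => by ring
        have h3 : ((1 - s * ‖x - y‖ ^ 2 : ℝ) : ℂ) = 1 - s * ((‖x - y‖ ^ 2 : ℝ) : ℂ) := by
          push_cast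
          ring
        rw [h2, pow_succ]
        nth_rewrite 2 [h3]
        rw [h1]
        ring
      · exact ((hint x hf hfc).const_mul _).add (integrable_finsetSum _ fun i _ =>
          ((hint x (hc i) hfc.mul_left).const_mul _).const_mul _)
      · exact (hint x hn hfc.mul_left).const_mul _
      · exact (hint x hf hfc).const_mul _
      · exact integrable_finsetSum _ fun i _ =>
          ((hint x (hc i) hfc.mul_left).const_mul _).const_mul _
    rw [h]
    refine sub_mem (add_mem (mul_mem (sub_mem (one_mem _) ?_) (ih hf hfc))
      (sum_mem fun i _ => Subalgebra.smul_mem _ (mul_mem (inner_mem_multipliers b _)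
        (ih (hc i) hfc.mul_left)) _)) (Subalgebra.smul_mem _ (ih hn hfc.mul_left) _)
    exact Subalgebra.smul_mem _ (norm_sq_mem_multipliers b) _

end Kernels

/-! ### Density of $\mathcal D_0(B_R)$ -/

section Density

open Filter Topology ContinuousLinearMap
open scoped Convolution

variable {E : Type*} [NormedAddCommGroup E] [InnerProductSpace ℝ E] [FiniteDimensional ℝ E]
  {N : ℕ} {R : ℝ}

/-- There are radial smooth cutoff functions. -/
theorem exists_radial_cutoff {ρ : ℝ} (hρ : 0 ≤ ρ) (hρR : ρ < R) :
    ∃ χ : Test E R, IsRadial χ ∧ ∀ x, ‖x‖ ≤ ρ → χ x = 1 := by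
  have hpos : 0 < R ^ 2 - ρ ^ 2 := by nlinarith
  have hd : ContDiff ℝ ∞ fun r : ℝ =>
      (Real.smoothTransition ((R ^ 2 - r ^ 2) / (R ^ 2 - ρ ^ 2)) : ℂ) :=
    Complex.ofRealCLM.contDiff.comp (Real.smoothTransition.contDiff.comp
      ((contDiff_const.sub (contDiff_id.pow 2)).div_const _))
  have he : Function.Even fun r : ℝ =>
      (Real.smoothTransition ((R ^ 2 - r ^ 2) / (R ^ 2 - ρ ^ 2)) : ℂ) := fun r => by simp
  have hs (r : ℝ) (hr : R < |r|) :
      (Real.smoothTransition ((R ^ 2 - r ^ 2) / (R ^ 2 - ρ ^ 2)) : ℂ) = 0 := by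
    have h1 : R ^ 2 ≤ r ^ 2 := sq_le_sq.2 (by rw [abs_of_nonneg (hρ.trans hρR.le)]; exact hr.le)
    rw [Real.smoothTransition.zero_of_nonpos (div_nonpos_of_nonpos_of_nonneg (by linarith) hpos.le),
      Complex.ofReal_zero]
  refine ⟨ofProfile E hd he hs, isRadial_ofProfile _ _ _, fun x hx => ?_⟩
  have h1 : ‖x‖ ^ 2 ≤ ρ ^ 2 := by gcongr
  rw [ofProfile_apply, Real.smoothTransition.one_of_one_le ((one_le_div hpos).2 (by linarith)),
    Complex.ofReal_one]

/-- The approximants are a radial cutoff $\chi$ times Landau convolutions of $f$. The room between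
$\rho$ and $R$ allows $\chi=1$ on the support of $f$, so $f=\chi f$ and Leibniz's rule controls all
derivatives of the error. -/
theorem mem_closure_test0_of_support (b : OrthonormalBasis (Fin N) ℝ E) {ρ : ℝ} (hρ : 0 ≤ ρ)
    (hρR : ρ < R) {f : Test E R} (hf : ∀ x, ρ < ‖x‖ → f x = 0) :
    f ∈ closure (test0 b R : Set (Test E R)) := by
  borelize E
  obtain ⟨χ, hχ, hχ1⟩ := exists_radial_cutoff (E := E) hρ hρR
  -- With radius $2R$ the kernel is given by its polynomial formula at $x-y$ for all $x,y\in B_R$.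
  have hL : 0 < 2 * R := by linarith
  have hloc (k : ℕ) : LocallyIntegrable (landau E (2 * R) k) :=
    (integrable_landau _ k).locallyIntegrable
  have hsmooth (k : ℕ) : ContDiff ℝ ∞ (landau E (2 * R) k ⋆[lsmul ℝ ℝ] f : E → ℂ) :=
    f.hasCompactSupport.contDiff_convolution_right (n := ⊤) _ (hloc k) f.contDiff
  let h (k : ℕ) : Test E R := Test.mk'
    (fun x => χ x * (landau E (2 * R) k ⋆[lsmul ℝ ℝ] f : E → ℂ) x)
    (χ.contDiff.mul (hsmooth k)) (fun x hx => by rw [χ.apply_eq_zero hx, zero_mul])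
  choose C hC using exists_lipschitzWith_iteratedFDeriv f
  choose D hD using exists_bound_iteratedFDeriv χ
  refine mem_closure_of_tendsto (f := h) (b := atTop) (tendsto_of_norm_iteratedFDeriv_le
    (B := fun i k => ∑ j ∈ Finset.range (i + 1), (i.choose j : ℝ) * D j *
      (C (i - j) * ∫ y, landau E (2 * R) k y * ‖y‖)) (fun i => ?_) fun i k x _ => ?_)
    (.of_forall fun k => ?_)
  · have h0 := tendsto_landau (E := E) hL continuous_norm
    rw [norm_zero] at h0
    rw [show (0 : ℝ) = ∑ j ∈ Finset.range (i + 1), (i.choose j : ℝ) * D j * (C (i - j) * 0) by simp]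
    exact tendsto_finsetSum _ fun j _ => (h0.const_mul _).const_mul _
  · have h1 : (fun x => h k x - f x) = fun x =>
        χ x * ((landau E (2 * R) k ⋆[lsmul ℝ ℝ] f : E → ℂ) - (f : E → ℂ)) x := by
      funext x
      have h2 : f x = χ x * f x := by
        rcases le_or_gt ‖x‖ ρ with hx | hx
        · rw [hχ1 x hx, one_mul]
        · rw [hf x hx, mul_zero]
      change χ x * _ - f x = χ x * (_ - f x)
      rw [mul_sub, ← h2]
    rw [h1]
    refine (norm_iteratedFDeriv_mul_le χ.contDiff ((hsmooth k).sub f.contDiff) x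
      (by exact_mod_cast le_top)).trans (Finset.sum_le_sum fun j _ => ?_)
    have h2 : ‖iteratedFDeriv ℝ (i - j) ((landau E (2 * R) k ⋆[lsmul ℝ ℝ] f : E → ℂ) - (f : E → ℂ)) x‖ ≤
        C (i - j) * ∫ y, landau E (2 * R) k y * ‖y‖ := by
      rw [iteratedFDeriv_sub_apply (contDiff_infty.1 (hsmooth k) _).contDiffAt
        (contDiff_infty.1 f.contDiff _).contDiffAt,
        iteratedFDeriv_convolution_lsmul (hloc k) f.contDiff f.hasCompactSupport]
      exact norm_landau_convolution_sub_le hL k (hC (i - j)) x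
    gcongr
    · exact mul_nonneg (Nat.cast_nonneg _) ((norm_nonneg _).trans (hD j x))
    · exact hD j x
    · exact h2
  · obtain ⟨ψ, hψ, hψx⟩ := integral_landau_mem_multipliers (R := R) b (1 / (2 * R) ^ 2) k
      f.continuous f.hasCompactSupport χ (hχ.mem_test0 b)
    set a : ℝ := (∫ y in Metric.closedBall (0 : E) (2 * R), (1 - (‖y‖ / (2 * R)) ^ 2) ^ k)⁻¹
    have h1 : h k = (a : ℂ) • ψ := by
      ext x
      change χ x * (landau E (2 * R) k ⋆[lsmul ℝ ℝ] f : E → ℂ) x = a * ψ x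
      rw [hψx]
      rcases le_or_gt ‖x‖ R with hx | hx
      · rw [convolution_lsmul_swap, mul_comm, ← mul_assoc]
        dsimp only
        rw [← integral_const_mul]
        congr 2 with y
        rcases le_or_gt ‖y‖ R with hy | hy
        · have hxy : x - y ∈ Metric.closedBall (0 : E) (2 * R) := by
            rw [mem_closedBall_zero_iff]
            linarith [norm_sub_le x y]
          have hl : landau E (2 * R) k (x - y) = a * (1 - (‖x - y‖ / (2 * R)) ^ 2) ^ k :=
            Set.indicator_of_mem hxy _
          rw [hl, Complex.real_smul, div_pow]
          push_cast
          ring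
        · rw [f.apply_eq_zero hy, smul_zero, mul_zero, mul_zero]
      · rw [χ.apply_eq_zero hx]
        ring
    change h k ∈ test0 b R
    rw [h1]
    exact Submodule.smul_mem _ _ hψ

theorem tendsto_dilation (f : Test E R) {ι : Type*} {l : Filter ι} {m : ι → ℝ}
    (hm : Tendsto m l (𝓝 1)) {h : ι → Test E R} (hh : ∀ k x, h k x = f (m k • x)) :
    Tendsto h l (𝓝 f) := by
  choose C hC using exists_lipschitzWith_iteratedFDeriv f
  choose D hD using exists_bound_iteratedFDeriv f
  refine tendsto_of_norm_iteratedFDeriv_le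
    (B := fun i k => |m k| ^ i * (C i * (|m k - 1| * R)) + |m k ^ i - 1| * D i)
    (fun i => ?_) fun i k x hx => ?_
  · have : Continuous fun μ : ℝ => |μ| ^ i * (C i * (|μ - 1| * R)) + |μ ^ i - 1| * D i := by
      fun_prop
    simpa [Function.comp_def] using (this.tendsto 1).comp hm
  · have hfi : ContDiff ℝ i f := f.contDiff.of_le (by exact_mod_cast le_top)
    set μ := m k with hμ
    have h1 : (fun x => h k x - f x) = (fun x => f (μ • x)) - f := funext fun x => by
      rw [hh]
      rfl
    have hdil : ContDiff ℝ i fun x => f (μ • x) := hfi.comp (contDiff_const_smul μ)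
    rw [h1, iteratedFDeriv_sub_apply hdil.contDiffAt hfi.contDiffAt, iteratedFDeriv_comp_const_smul μ hfi]
    have h2 : μ ^ i • iteratedFDeriv ℝ i f (μ • x) - iteratedFDeriv ℝ i f x =
        μ ^ i • (iteratedFDeriv ℝ i f (μ • x) - iteratedFDeriv ℝ i f x) +
          (μ ^ i - 1) • iteratedFDeriv ℝ i f x := by
      rw [smul_sub, sub_smul, one_smul]
      abel
    have h3 : ‖iteratedFDeriv ℝ i f (μ • x) - iteratedFDeriv ℝ i f x‖ ≤ C i * (|μ - 1| * R) := by
      refine ((hC i).norm_sub_le _ _).trans ?_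
      have h4 : μ • x - x = (μ - 1) • x := by rw [sub_smul, one_smul]
      rw [h4, norm_smul, Real.norm_eq_abs]
      gcongr
    change ‖μ ^ i • iteratedFDeriv ℝ i f (μ • x) - iteratedFDeriv ℝ i f x‖ ≤ _
    rw [h2]
    refine (norm_add_le _ _).trans ?_
    rw [norm_smul, norm_smul, Real.norm_eq_abs, Real.norm_eq_abs, abs_pow]
    gcongr
    exact hD i x

theorem dense_test0 (b : OrthonormalBasis (Fin N) ℝ E) (hR : 0 ≤ R) :
    Dense (test0 b R : Set (Test E R)) := by
  intro f
  rcases hR.eq_or_lt with rfl | hR'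
  -- For $R=0$ there is no room to shrink the support, but every test function is radial.
  · refine subset_closure (IsRadial.mem_test0 (isRadial_of_apply_eq fun x y hxy => ?_) b)
    rcases eq_or_ne x 0 with rfl | hx
    · rw [norm_zero] at hxy
      rw [norm_eq_zero.1 hxy.symm]
    · have hx' := norm_pos_iff.2 hx
      rw [f.apply_eq_zero hx', f.apply_eq_zero (hxy ▸ hx')]
  · have hm (k : ℕ) : 1 < 1 + 1 / ((k : ℝ) + 1) := by
      have : 0 < 1 / ((k : ℝ) + 1) := by positivity
      linarith
    have hz (k : ℕ) (x : E) (hx : R / (1 + 1 / ((k : ℝ) + 1)) < ‖x‖) :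
        f ((1 + 1 / ((k : ℝ) + 1)) • x) = 0 := by
      have h1 := hm k
      apply f.apply_eq_zero
      rw [norm_smul, Real.norm_of_nonneg (by linarith), mul_comm]
      exact (div_lt_iff₀ (by linarith)).1 hx
    let h (k : ℕ) : Test E R := Test.mk' (fun x => f ((1 + 1 / ((k : ℝ) + 1)) • x))
      (f.contDiff.comp (contDiff_const_smul _)) fun x hx =>
        hz k x ((div_le_self hR (hm k).le).trans_lt hx)
    have ht : Tendsto h atTop (𝓝 f) := by
      refine tendsto_dilation f (m := fun k : ℕ => 1 + 1 / ((k : ℝ) + 1)) ?_ fun _ _ => rfl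
      simpa using tendsto_one_div_add_atTop_nhds_zero_nat.const_add (1 : ℝ)
    refine isClosed_closure.mem_of_tendsto ht (.of_forall fun k => ?_)
    exact mem_closure_test0_of_support b (div_nonneg hR (by linarith [hm k]))
      (div_lt_self hR' (hm k)) (hz k)

end Density

/-! ### Weight decomposition under the circle -/

section Weights

section CircleRepresentation

/-- The evaluations at the points of `X` span the dual of a finite dimensional space of functions
on `X`. -/
theorem span_evaluation_eq_top {X V : Type*} [AddCommGroup V] [Module ℂ V] [FiniteDimensional ℂ V]
    (ev : X → Module.Dual ℂ V) (hev : ∀ v, (∀ x, ev x v = 0) → v = 0) :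
    Submodule.span ℂ (Set.range ev) = ⊤ := by
  refine Submodule.span_eq_top_of_ne_zero fun v hv => ?_
  by_contra! h
  exact hv (hev v fun x => h (ev x) (Set.mem_range_self x))

/-- By irrationality of $\pi$, rotation by one radian has infinite order, so this single rotation
separates all weights. -/
theorem circle_exp_one_zpow_injective :
    Function.Injective fun n : ℤ => ((Circle.exp 1 : Circle) : ℂ) ^ n := by
  intro n m h
  simp only [Circle.coe_exp, Complex.ofReal_one, one_mul, ← Complex.exp_int_mul] at h
  obtain ⟨k, hk⟩ := Complex.exp_eq_exp_iff_exists_int.1 h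
  have h1 : (n : ℝ) = m + k * (2 * Real.pi) := by
    have h2 : ((n : ℂ)) = m + k * (2 * Real.pi) := by
      apply mul_right_cancel₀ Complex.I_ne_zero
      rw [hk]
      ring
    exact_mod_cast h2
  rcases eq_or_ne k 0 with rfl | hk0
  · simpa using h1
  · exfalso
    refine irrational_pi ⟨((n - m) / (2 * k) : ℚ), ?_⟩
    have : (k : ℝ) ≠ 0 := by exact_mod_cast hk0
    push_cast
    rw [h1]
    field_simp
    ring

/-- The component of weight `n` of a function on the plane, for the action of the circle by
rotations. -/
def weightComponent (w : ℂ → ℂ) (n : ℤ) (z : ℂ) : ℂ :=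
  fourierCoeff (fun t : UnitAddCircle => w (AddCircle.toCircle t * z)) n

theorem weightComponent_rotate (w : ℂ → ℂ) (n : ℤ) (u : Circle) (z : ℂ) :
    weightComponent w n (u * z) = (u : ℂ) ^ n * weightComponent w n z := by
  obtain ⟨s, rfl⟩ := (AddCircle.homeomorphCircle (one_ne_zero (α := ℝ))).surjective u
  rw [AddCircle.homeomorphCircle_apply]
  have h := integral_add_right_eq_self (μ := AddCircle.haarAddCircle)
    (fun t : UnitAddCircle => fourier (-n) t • w (AddCircle.toCircle t * z)) s
  rw [weightComponent, weightComponent, fourierCoeff, fourierCoeff, ← h, ← integral_const_mul]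
  congr 1 with t
  simp only [fourier_apply, smul_eq_mul, AddCircle.toCircle_add, AddCircle.toCircle_zsmul, zpow_neg,
    Circle.coe_mul, Circle.coe_inv, Circle.coe_zpow, mul_zpow, mul_inv]
  have h0 : ((AddCircle.toCircle s : Circle) : ℂ) ^ n ≠ 0 := zpow_ne_zero _ (Circle.coe_ne_zero _)
  field_simp

variable {W : Submodule ℂ (ℂ → ℂ)} [FiniteDimensional ℂ W]

/-- The component is an integral of rotated copies of $w$, and integrating their coordinates in a
basis of $W$ stays in $W$. -/
theorem weightComponent_mem (hc : ∀ w ∈ W, Continuous w)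
    (hrot : ∀ w ∈ W, ∀ u : Circle, (fun z => w (u * z)) ∈ W) {w : ℂ → ℂ} (hw : w ∈ W) (n : ℤ) :
    weightComponent w n ∈ W := by
  let ev (z : ℂ) : Module.Dual ℂ W := (LinearMap.proj z).comp W.subtype
  have hspan := span_evaluation_eq_top ev fun v hv => Subtype.ext (funext hv)
  let wt (t : UnitAddCircle) : W := ⟨fun z => w (AddCircle.toCircle t * z), hrot w hw _⟩
  -- Point evaluations span the dual, so pointwise continuity gives continuity of every coordinate.
  have hcont (φ : Module.Dual ℂ W) : Continuous fun t => φ (wt t) := by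
    have hφ : φ ∈ Submodule.span ℂ (Set.range ev) := hspan ▸ Submodule.mem_top
    induction hφ using Submodule.span_induction with
    | mem φ h =>
      obtain ⟨z, rfl⟩ := h
      exact (hc w hw).comp ((continuous_subtype_val.comp AddCircle.continuous_toCircle).mul
        continuous_const)
    | zero => exact continuous_const
    | add φ ψ _ _ hφ hψ => exact hφ.add hψ
    | smul c φ _ hφ => exact hφ.const_smul c
  let B := Module.finBasis ℂ W
  have h : weightComponent w n = ∑ j, fourierCoeff (fun t => B.coord j (wt t)) n • (B j : ℂ → ℂ) := by
    funext z
    simp only [weightComponent, fourierCoeff, Finset.sum_apply, Pi.smul_apply, smul_eq_mul,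
      ← integral_mul_const]
    rw [← integral_finsetSum]
    · congr 1 with t
      have h1 : w (AddCircle.toCircle t * z) = ∑ j, B.coord j (wt t) * (B j : ℂ → ℂ) z := by
        have h2 := congrFun (congrArg Subtype.val (B.sum_repr (wt t))) z
        simp only [Submodule.coe_sum, Finset.sum_apply] at h2
        exact h2.symm
      rw [h1, Finset.mul_sum]
      exact Finset.sum_congr rfl fun j _ => (mul_assoc _ _ _).symm
    · intro j _
      exact (((fourier (-n)).continuous.mul (hcont _)).mul
        continuous_const).integrable_of_hasCompactSupport (HasCompactSupport.of_compactSpace _)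
  rw [h]
  exact sum_mem fun j _ => W.smul_mem _ (B j).2

/-- Nonzero components are eigenvectors of rotation by one radian with distinct eigenvalues, hence
independent in $W$. -/
theorem finite_weightComponent_ne_zero (hc : ∀ w ∈ W, Continuous w)
    (hrot : ∀ w ∈ W, ∀ u : Circle, (fun z => w (u * z)) ∈ W) {w : ℂ → ℂ} (hw : w ∈ W) :
    {n : ℤ | weightComponent w n ≠ 0}.Finite := by
  let T : Module.End ℂ (ℂ → ℂ) := LinearMap.funLeft ℂ ℂ fun z => (Circle.exp 1 : Circle) * z
  have hT (n : {n : ℤ // weightComponent w n ≠ 0}) :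
      T.HasEigenvector (((Circle.exp 1 : Circle) : ℂ) ^ n.1) (weightComponent w n.1) :=
    ⟨Module.End.mem_eigenspace_iff.2
      (funext fun z => weightComponent_rotate w n.1 (Circle.exp 1) z), n.2⟩
  have hinj : Function.Injective fun n : {n : ℤ // weightComponent w n ≠ 0} =>
      ((Circle.exp 1 : Circle) : ℂ) ^ n.1 :=
    fun n m h => Subtype.ext (circle_exp_one_zpow_injective h)
  have hli := T.eigenvectors_linearIndependent' _ hinj _ hT
  have hli' : LinearIndependent ℂ fun n : {n : ℤ // weightComponent w n ≠ 0} =>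
      (⟨weightComponent w n.1, weightComponent_mem hc hrot hw n⟩ : W) :=
    LinearIndependent.of_comp W.subtype hli
  exact hli'.finite_of_isNoetherian

/-- A function in a finite dimensional rotation invariant space of continuous functions on the plane
is the sum of finitely many weight components. -/
theorem exists_sum_weightComponent (hc : ∀ w ∈ W, Continuous w)
    (hrot : ∀ w ∈ W, ∀ u : Circle, (fun z => w (u * z)) ∈ W) {w : ℂ → ℂ} (hw : w ∈ W) :
    ∃ S : Finset ℤ, ∀ z, w z = ∑ n ∈ S, weightComponent w n z := by
  have hfin := finite_weightComponent_ne_zero hc hrot hw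
  refine ⟨hfin.toFinset, fun z => ?_⟩
  let f : C(UnitAddCircle, ℂ) := ⟨fun t => w (AddCircle.toCircle t * z),
    (hc w hw).comp ((continuous_subtype_val.comp AddCircle.continuous_toCircle).mul
      continuous_const)⟩
  have hz (n : ℤ) (hn : n ∉ hfin.toFinset) : fourierCoeff f n = 0 := by
    have h1 : weightComponent w n = 0 := by simpa using hn
    exact congrFun h1 z
  -- Only finitely many Fourier coefficients are nonzero, so the series represents the function
  -- pointwise; at $t=0$ it gives $w(z)$.
  have hs := has_pointwise_sum_fourier_series_of_summable
    (summable_of_ne_finset_zero hz) (0 : UnitAddCircle)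
  have hf0 : f 0 = w z := by simp [f]
  rw [hf0] at hs
  have h2 := hs.unique (hasSum_sum_of_ne_finset_zero (s := hfin.toFinset) fun n hn => by
    rw [hz n hn, zero_smul])
  rw [h2]
  refine Finset.sum_congr rfl fun n _ => ?_
  rw [fourier_eval_zero, smul_eq_mul, mul_one]
  rfl

end CircleRepresentation

theorem exists_radial_of_weight (n : ℕ) {F : ℂ → ℂ} (hF : ContDiff ℝ ∞ F)
    (hw : ∀ (u : Circle) (z : ℂ), F (u * z) = (u : ℂ) ^ n * F z) {R : ℝ} (hR : 0 ≤ R)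
    (hsupp : ∀ z, R < ‖z‖ → F z = 0) :
    ∃ d : ℝ → ℂ, ContDiff ℝ ∞ d ∧ d.Even ∧ (∀ r, R < |r| → d r = 0) ∧
      ∀ z, F z = z ^ n * d ‖z‖ := by
  obtain ⟨d, hd, he, h⟩ := exists_even_of_weight n hF hw
  refine ⟨d, hd, he, fun r hr => ?_, fun z => ?_⟩
  · have h1 := h r
    rw [hsupp r (by simpa using hr)] at h1
    have hr0 : (r : ℂ) ≠ 0 := by
      have : 0 < |r| := hR.trans_lt hr
      simpa using this
    simpa [hr0] using h1
  · have hz : (Circle.exp z.arg : Circle) * (‖z‖ : ℂ) = z := by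
      rw [Circle.coe_exp, mul_comm, Complex.norm_mul_exp_arg_mul_I]
    calc F z = F ((Circle.exp z.arg : Circle) * (‖z‖ : ℂ)) := by rw [hz]
      _ = ((Circle.exp z.arg : Circle) * (‖z‖ : ℂ)) ^ n * d ‖z‖ := by rw [hw, h, mul_pow, mul_assoc]
      _ = z ^ n * d ‖z‖ := by rw [hz]

/-- Conjugation turns weight $n$ into weight $-n$, so the symmetrized function depends on the sign
of $n$ only through $d$. -/
theorem exists_radial_of_zpow_weight (n : ℤ) {F : ℂ → ℂ} (hF : ContDiff ℝ ∞ F)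
    (hw : ∀ (u : Circle) (z : ℂ), F (u * z) = (u : ℂ) ^ n * F z) {R : ℝ} (hR : 0 ≤ R)
    (hsupp : ∀ z, R < ‖z‖ → F z = 0) :
    ∃ d : ℝ → ℂ, ContDiff ℝ ∞ d ∧ d.Even ∧ (∀ r, R < |r| → d r = 0) ∧
      ∀ z, F z + F ((starRingEnd ℂ) z) =
        d ‖z‖ * (z ^ n.natAbs + (starRingEnd ℂ) z ^ n.natAbs) := by
  rcases le_total 0 n with hn | hn
  · obtain ⟨m, rfl⟩ := Int.eq_ofNat_of_zero_le hn
    obtain ⟨d, hd, he, hs, h⟩ := exists_radial_of_weight m hF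
      (fun u z => by simpa using hw u z) hR hsupp
    refine ⟨d, hd, he, hs, fun z => ?_⟩
    rw [h, h, RCLike.norm_conj, Int.natAbs_natCast]
    ring
  · obtain ⟨m, hm⟩ := Int.eq_ofNat_of_zero_le (neg_nonneg.2 hn)
    obtain ⟨d, hd, he, hs, h⟩ := exists_radial_of_weight m
      (F := fun z => F ((starRingEnd ℂ) z)) (hF.comp Complex.conjCLE.contDiff)
      (fun u z => by
        have h1 := hw u⁻¹ ((starRingEnd ℂ) z)
        rw [Circle.coe_inv_eq_conj, ← map_mul, ← Circle.coe_inv_eq_conj, Circle.coe_inv, inv_zpow,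
          ← zpow_neg, hm] at h1
        simpa using h1) hR (fun z hz => hsupp _ (by simpa using hz))
    refine ⟨d, hd, he, hs, fun z => ?_⟩
    have h1 := h ((starRingEnd ℂ) z)
    simp only [Complex.conj_conj, RCLike.norm_conj] at h1
    rw [h, h1, show n.natAbs = m by omega]
    ring

end Weights

/-! ### Finite vectors via zonal functions -/

section FiniteVectors

section Isometries

variable {E F : Type*} [NormedAddCommGroup E] [InnerProductSpace ℝ E]
  [NormedAddCommGroup F] [InnerProductSpace ℝ F]

/-- The orthogonal group acts transitively on isometric embeddings. -/
theorem exists_isometryEquiv_comp [FiniteDimensional ℝ E] (i j : F →ₗᵢ[ℝ] E) :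
    ∃ g : E ≃ₗᵢ[ℝ] E, ∀ z, g (i z) = j z := by
  let e : F ≃ₗᵢ[ℝ] LinearMap.range i.toLinearMap :=
    { LinearEquiv.ofInjective i.toLinearMap i.injective with norm_map' := i.norm_map }
  refine ⟨((j.comp e.symm.toLinearIsometry).extend).toLinearIsometryEquiv rfl, fun z => ?_⟩
  have h := (j.comp e.symm.toLinearIsometry).extend_apply (e z)
  rw [LinearIsometry.coe_toLinearIsometryEquiv]
  refine h.trans ?_
  exact congrArg j (e.symm_apply_apply z)

/-- The isometric embedding of the plane with values `e` and `v` on `1` and `I`. -/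
def planeEmbedding (e v : E) (he : ‖e‖ = 1) (hv : ‖v‖ = 1) (hev : inner ℝ e v = 0) :
    ℂ →ₗᵢ[ℝ] E where
  toFun z := z.re • e + z.im • v
  map_add' z w := by
    simp only [Complex.add_re, Complex.add_im, add_smul]
    abel
  map_smul' r z := by simp [smul_smul]
  norm_map' z := by
    change ‖z.re • e + z.im • v‖ = ‖z‖
    rw [← sq_eq_sq₀ (norm_nonneg _) (norm_nonneg _), norm_add_sq_real, Complex.sq_norm,
      Complex.normSq_apply, norm_smul, norm_smul, he, hv, real_inner_smul_left,
      real_inner_smul_right, hev]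
    simp [sq]

theorem planeEmbedding_apply (e v : E) (he : ‖e‖ = 1) (hv : ‖v‖ = 1) (hev : inner ℝ e v = 0)
    (z : ℂ) : planeEmbedding e v he hv hev z = z.re • e + z.im • v := rfl

end Isometries

variable {E : Type*} [NormedAddCommGroup E] [InnerProductSpace ℝ E] [FiniteDimensional ℝ E]
  {N : ℕ} {R : ℝ}

section Reproducing

variable [MeasurableSpace E] [BorelSpace E]

theorem integrable_conj_mul (f g : Test E R) :
    Integrable fun x => (starRingEnd ℂ) (f x) * g x :=
  ((Complex.continuous_conj.comp f.continuous).mul g.continuous).integrable_of_hasCompactSupport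
    g.hasCompactSupport.mul_left

/-- The `L²` pairing on `D(B_R)`. -/
def pairing (E : Type*) [NormedAddCommGroup E] [InnerProductSpace ℝ E] [FiniteDimensional ℝ E]
    [MeasurableSpace E] [BorelSpace E] (R : ℝ) :
    Test E R →ₗ⋆[ℂ] Test E R →ₗ[ℂ] ℂ :=
  LinearMap.mk₂'ₛₗ _ _ (fun f g => ∫ x, (starRingEnd ℂ) (f x) * g x)
    (fun f₁ f₂ g => by
      rw [← integral_add (integrable_conj_mul _ _) (integrable_conj_mul _ _)]
      congr 1 with x
      change (starRingEnd ℂ) (f₁ x + f₂ x) * g x = _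
      rw [map_add, add_mul])
    (fun c f g => by
      rw [smul_eq_mul, ← integral_const_mul]
      congr 1 with x
      change (starRingEnd ℂ) (c * f x) * g x = _
      rw [map_mul, mul_assoc])
    (fun f g₁ g₂ => by
      rw [← integral_add (integrable_conj_mul _ _) (integrable_conj_mul _ _)]
      congr 1 with x
      exact mul_add _ _ _)
    (fun c f g => by
      rw [RingHom.id_apply, smul_eq_mul, ← integral_const_mul]
      congr 1 with x
      exact mul_left_comm _ _ _)

theorem pairing_apply (f g : Test E R) :
    pairing E R f g = ∫ x, (starRingEnd ℂ) (f x) * g x := rfl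

theorem eq_zero_of_pairing_self {f : Test E R} (h : pairing E R f f = 0) : f = 0 := by
  by_contra hf
  obtain ⟨x, hx⟩ : ∃ x, f x ≠ 0 := by
    by_contra! h0
    exact hf (by ext x; exact h0 x)
  have h1 : pairing E R f f = ((∫ x, ‖f x‖ ^ 2 : ℝ) : ℂ) := by
    rw [pairing_apply, ← integral_complex_ofReal]
    congr 1 with x
    rw [mul_comm, Complex.mul_conj, Complex.normSq_eq_norm_sq]
  have h2 : 0 < ∫ x, ‖f x‖ ^ 2 :=
    (f.continuous.norm.pow 2).integral_pos_of_hasCompactSupport_nonneg_nonzero (x := x)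
      (f.hasCompactSupport.comp_left (g := fun z : ℂ => ‖z‖ ^ 2) (by simp))
      (fun x => by positivity) (by simpa using hx)
  rw [h1] at h
  exact h2.ne' (by exact_mod_cast h)

theorem pairing_rotation (g : E ≃ₗᵢ[ℝ] E) (f h : Test E R) :
    pairing E R (rotation E R g f) h = pairing E R f (rotation E R g⁻¹ h) := by
  rw [pairing_apply, pairing_apply, ← (g.measurePreserving).integral_comp
    g.toHomeomorph.measurableEmbedding]
  congr 1 with x
  rw [rotation_apply, rotation_apply, inv_inv]
  congr 3
  exact g.symm_apply_apply x

variable {V : Submodule ℂ (Test E R)} [FiniteDimensional ℂ V]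

/-- Riesz representation in finite dimension: definiteness of the pairing makes the functionals of a
basis independent, and a dimension count makes them span. Conjugated coefficients arise because the
pairing is antilinear in its first slot. -/
theorem exists_pairing_eq (φ : Module.Dual ℂ V) :
    ∃ k ∈ V, ∀ w : V, φ w = pairing E R k w := by
  let B := Module.finBasis ℂ V
  let J (k : Test E R) : Module.Dual ℂ V := (pairing E R k).comp V.subtype
  have hJ (c : Fin (Module.finrank ℂ V) → ℂ) :
      ∑ i, c i • J (B i) = J (∑ i, (starRingEnd ℂ) (c i) • (B i : Test E R)) := by
    ext w
    simp [J]
  have hmem (c : Fin (Module.finrank ℂ V) → ℂ) :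
      ∑ i, (starRingEnd ℂ) (c i) • (B i : Test E R) ∈ V :=
    sum_mem fun i _ => V.smul_mem _ (B i).2
  have hli : LinearIndependent ℂ fun i => J (B i) := by
    rw [Fintype.linearIndependent_iff]
    intro c hc i
    rw [hJ] at hc
    have h0 : ∑ i, (starRingEnd ℂ) (c i) • (B i : Test E R) = 0 :=
      eq_zero_of_pairing_self (DFunLike.congr_fun hc ⟨_, hmem c⟩)
    have h1 : ∑ i, (starRingEnd ℂ) (c i) • B i = 0 := Subtype.ext (by simpa using h0)
    simpa using Fintype.linearIndependent_iff.1 B.linearIndependent _ h1 i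
  have hspan := hli.span_eq_top_of_card_eq_finrank' (by simp)
  have hφ : φ ∈ Submodule.span ℂ (Set.range fun i => J (B i)) := hspan ▸ Submodule.mem_top
  obtain ⟨c, hc⟩ := (Submodule.mem_span_range_iff_exists_fun ℂ).1 hφ
  exact ⟨_, hmem c, fun w => by rw [← hc, hJ]; rfl⟩

/-- A finite dimensional space of functions that is stable under rotations is spanned by zonal
functions. -/
theorem mem_span_zonal (hV : ∀ g, ∀ f ∈ V, rotation E R g f ∈ V) {f : Test E R} (hf : f ∈ V) :
    f ∈ Submodule.span ℂ {k | k ∈ V ∧ ∃ y, ∀ g : E ≃ₗᵢ[ℝ] E, g y = y → rotation E R g k = k} := by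
  let ev (y : E) : Module.Dual ℂ V :=
    { toFun := fun w => (w : Test E R) y
      map_add' := fun _ _ => rfl
      map_smul' := fun _ _ => rfl }
  have hspan := span_evaluation_eq_top ev fun v hv => Subtype.ext (by ext x; exact hv x)
  have huniq {k l : Test E R} (hk : k ∈ V) (hl : l ∈ V)
      (h : ∀ w : V, pairing E R k w = pairing E R l w) : k = l := by
    refine sub_eq_zero.1 (eq_zero_of_pairing_self ?_)
    have h1 := h ⟨k - l, sub_mem hk hl⟩
    have h2 : pairing E R (k - l) = pairing E R k - pairing E R l := map_sub _ k l
    rw [h2, LinearMap.sub_apply]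
    exact sub_eq_zero.2 h1
  have key (φ : Module.Dual ℂ V) : ∃ k ∈ Submodule.span ℂ {k | k ∈ V ∧ ∃ y,
      ∀ g : E ≃ₗᵢ[ℝ] E, g y = y → rotation E R g k = k}, ∀ w : V, φ w = pairing E R k w := by
    have hφ : φ ∈ Submodule.span ℂ (Set.range ev) := hspan ▸ Submodule.mem_top
    induction hφ using Submodule.span_induction with
    | mem φ h =>
      obtain ⟨y, rfl⟩ := h
      obtain ⟨k, hk, hky⟩ := exists_pairing_eq (ev y)
      -- If $g$ fixes $y$, the rotated kernel also represents evaluation at $y$, by invariance of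
      -- the pairing; uniqueness makes it equal to $k$.
      refine ⟨k, Submodule.subset_span ⟨hk, y, fun g hg => huniq (hV g k hk) hk fun w => ?_⟩, hky⟩
      have h1 := hky ⟨rotation E R g⁻¹ w, hV _ _ w.2⟩
      rw [pairing_rotation, ← hky w]
      refine h1.symm.trans ?_
      change (w : Test E R) (g⁻¹⁻¹ y) = (w : Test E R) y
      rw [inv_inv, hg]
    | zero => exact ⟨0, zero_mem _, fun w => by simp⟩
    | add φ ψ _ _ hφ hψ =>
      obtain ⟨k, hk, h⟩ := hφ
      obtain ⟨l, hl, h'⟩ := hψ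
      exact ⟨k + l, add_mem hk hl, fun w => by simp [h, h']⟩
    | smul c φ _ hφ =>
      obtain ⟨k, hk, h⟩ := hφ
      exact ⟨(starRingEnd ℂ) c • k, Submodule.smul_mem _ _ hk, fun w => by simp [h]⟩
  -- The functional $\langle f,\cdot\rangle$ is represented by $f$ itself, so uniqueness identifies
  -- $f$ with a combination of zonal kernels.
  obtain ⟨k, hk, h⟩ := key ((pairing E R f).comp V.subtype)
  have hkV : k ∈ V := Submodule.span_le.2 (fun _ h => h.1) hk
  rwa [huniq hf hkV h]

end Reproducing

/-- On a line every test function belongs to `D_0(B_R)`. -/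
theorem mem_test0_of_line (b : OrthonormalBasis (Fin N) ℝ E) (hR : 0 ≤ R) {e : E} (he : ‖e‖ = 1)
    (hE : ∀ x : E, x = (inner ℝ e x : ℝ) • e) (k : Test E R) : k ∈ test0 b R := by
  let c (r : ℝ) : ℂ := k (r • e)
  have hc : ContDiff ℝ ∞ c := k.contDiff.comp (contDiff_id.smul contDiff_const)
  have hcs (r : ℝ) (hr : R < |r|) : c r = 0 :=
    k.apply_eq_zero (by simpa [norm_smul, he] using hr)
  have hcn : ContDiff ℝ ∞ fun r => c (-r) := hc.comp contDiff_neg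
  obtain ⟨d, hd, hde, hdc⟩ := exists_even_of_odd (g := fun r => c r - c (-r)) (hc.sub hcn)
    (fun r => by simp)
  obtain ⟨h₀, hh₀, heq₀⟩ := exists_mem_test0_zonal b e 0 (R := R) (d := fun r => c r + c (-r))
    (hc.add hcn) (fun r => by simp [add_comm])
    (fun r hr => by rw [hcs r hr, hcs (-r) (by rwa [abs_neg]), add_zero])
  obtain ⟨h₁, hh₁, heq₁⟩ := exists_mem_test0_zonal b e 1 hd hde (R := R) (fun r hr => by
    have h1 := hdc r
    rw [hcs r hr, hcs (-r) (by rwa [abs_neg]), sub_zero] at h1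
    have hr0 : (r : ℂ) ≠ 0 := by
      have : 0 < |r| := hR.trans_lt hr
      simpa using this
    simpa [hr0] using h1.symm)
  -- Both `h₀` and `h₁` carry a factor $2$: they are $2(c(r)+c(-r))$ and $2r\,d(r)=2(c(r)-c(-r))$.
  have h : k = (4⁻¹ : ℂ) • (h₀ + h₁) := by
    ext x
    change k x = 4⁻¹ * (h₀ x + h₁ x)
    set r : ℝ := inner ℝ e x with hr
    have hx : ‖x‖ = |r| := by
      rw [hE x, norm_smul, he, mul_one, Real.norm_eq_abs]
    have hkx : k x = c r := congrArg k (hE x)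
    rw [heq₀ x r (by simpa using hr) (by simp [hx]), heq₁ x r (by simpa using hr) (by simp [hx]), hx,
      hkx]
    have h1 : c |r| + c (-|r|) = c r + c (-r) := by
      rcases abs_choice r with h | h <;> rw [h]
      rw [neg_neg, add_comm]
    have h2 : d |r| = d r := by
      rcases abs_choice r with h | h <;> rw [h]
      exact hde r
    have h3 := hdc r
    simp only [h1, h2, Complex.conj_ofReal, pow_zero, pow_one]
    linear_combination (2 : ℂ)⁻¹ * h3
  rw [h]
  exact Submodule.smul_mem _ _ (add_mem hh₀ hh₁)

/-- Zonal functions in finite dimensional rotation stable spaces belong to `D_0(B_R)`. -/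
theorem mem_test0_of_zonal (b : OrthonormalBasis (Fin N) ℝ E) (hR : 0 ≤ R)
    {V : Submodule ℂ (Test E R)} [FiniteDimensional ℂ V]
    (hV : ∀ g, ∀ f ∈ V, rotation E R g f ∈ V) {k : Test E R} (hk : k ∈ V) {e : E} (he : ‖e‖ = 1)
    (hz : ∀ g : E ≃ₗᵢ[ℝ] E, g e = e → rotation E R g k = k) : k ∈ test0 b R := by
  have hinv (g : E ≃ₗᵢ[ℝ] E) (hg : g e = e) (x : E) : k (g x) = k x := by
    have h1 := DFunLike.congr_fun (hz g hg) (g x)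
    rw [← h1, rotation_apply]
    exact congrArg k (g.symm_apply_apply x)
  have hort (x : E) : inner ℝ e (x - (inner ℝ e x : ℝ) • e) = 0 := by
    rw [inner_sub_right, real_inner_smul_right, real_inner_self_eq_norm_sq, he]
    ring
  have hunit (x : E) (hx : x - (inner ℝ e x : ℝ) • e ≠ 0) :
      inner ℝ e ((‖x - (inner ℝ e x : ℝ) • e‖⁻¹ : ℝ) • (x - (inner ℝ e x : ℝ) • e)) = 0 := by
    rw [real_inner_smul_right, hort, mul_zero]
  by_cases hline : ∀ x : E, x = (inner ℝ e x : ℝ) • e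
  · exact mem_test0_of_line b hR he hline k
  · push Not at hline
    obtain ⟨x₀, hx₀⟩ := hline
    have hx₀' := sub_ne_zero.2 hx₀
    obtain ⟨v, hv, hev⟩ : ∃ v : E, ‖v‖ = 1 ∧ inner ℝ e v = 0 :=
      ⟨_, norm_smul_inv_norm (𝕜 := ℝ) hx₀', hunit x₀ hx₀'⟩
    let i := planeEmbedding e v he hv hev
    let res : Test E R →ₗ[ℂ] (ℂ → ℂ) :=
      { toFun := fun f z => f (i z)
        map_add' := fun _ _ => rfl
        map_smul' := fun _ _ => rfl }
    have hWc : ∀ w ∈ V.map res, Continuous w := by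
      rintro _ ⟨f, _, rfl⟩
      exact f.continuous.comp i.continuous
    have hWrot : ∀ w ∈ V.map res, ∀ u : Circle, (fun z => w (u * z)) ∈ V.map res := by
      rintro _ ⟨f, hf, rfl⟩ u
      obtain ⟨g, hg⟩ := exists_isometryEquiv_comp i (i.comp (_root_.rotation u).toLinearIsometry)
      refine ⟨rotation E R g⁻¹ f, hV _ _ hf, funext fun z => ?_⟩
      change f (g⁻¹⁻¹ (i z)) = f (i (u * z))
      rw [inv_inv, hg]
      rfl
    have hkW : res k ∈ V.map res := ⟨k, hk, rfl⟩
    obtain ⟨S, hS⟩ := exists_sum_weightComponent hWc hWrot hkW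
    have hterm (n : ℤ) : ∃ h ∈ test0 b R, ∀ (x : E) (z : ℂ), z.re = inner ℝ e x → ‖z‖ = ‖x‖ →
        h x = weightComponent (res k) n z + weightComponent (res k) n ((starRingEnd ℂ) z) := by
      obtain ⟨f, hf, hfn⟩ := weightComponent_mem hWc hWrot hkW n
      obtain ⟨d, hd, hde, hds, hdz⟩ := exists_radial_of_zpow_weight n (F := weightComponent (res k) n)
        (hfn ▸ f.contDiff.comp i.contDiff) (weightComponent_rotate _ n) hR (fun z hz => by
          rw [← hfn]
          exact f.apply_eq_zero (by rwa [i.norm_map]))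
      obtain ⟨h, hh, hx⟩ := exists_mem_test0_zonal b e n.natAbs hd hde hds
      refine ⟨h, hh, fun x z h1 h2 => ?_⟩
      rw [hx x z h1 h2, hdz, h2]
    choose h hh hx using hterm
    -- Conjugation of the plane fixes $1$, so an isometry of $E$ extending it fixes $e$.
    have hconj (z : ℂ) : k (i ((starRingEnd ℂ) z)) = k (i z) := by
      obtain ⟨g, hg⟩ := exists_isometryEquiv_comp i (i.comp Complex.conjLIE.toLinearIsometry)
      have hge : g e = e := by
        have h1 := hg 1
        simpa [i, planeEmbedding_apply] using h1
      rw [← hinv g hge (i z), hg]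
      rfl
    -- Every $x$ off the axis can be moved into the chosen plane by an isometry fixing $e$, so $k$
    -- is determined there.
    have hplane (x : E) : ∃ z : ℂ, z.re = inner ℝ e x ∧ ‖z‖ = ‖x‖ ∧ k x = k (i z) := by
      by_cases hx0 : x - (inner ℝ e x : ℝ) • e = 0
      · have hxi : x = i (inner ℝ e x : ℝ) := by
          simpa [i, planeEmbedding_apply] using sub_eq_zero.1 hx0
        refine ⟨(inner ℝ e x : ℝ), by simp, ?_, congrArg k hxi⟩
        rw [← i.norm_map, ← hxi]
      · let j := planeEmbedding e _ he (norm_smul_inv_norm (𝕜 := ℝ) hx0) (hunit x hx0)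
        have hxj : j ⟨inner ℝ e x, ‖x - (inner ℝ e x : ℝ) • e‖⟩ = x := by
          simp only [j, planeEmbedding_apply]
          rw [smul_smul]
          have : ‖x - (inner ℝ e x : ℝ) • e‖ ≠ 0 := norm_ne_zero_iff.2 hx0
          simp [this]
        obtain ⟨g, hg⟩ := exists_isometryEquiv_comp j i
        have hge : g e = e := by
          have h1 := hg 1
          simpa [i, j, planeEmbedding_apply] using h1
        refine ⟨⟨inner ℝ e x, ‖x - (inner ℝ e x : ℝ) • e‖⟩, rfl, ?_, ?_⟩
        · rw [← j.norm_map, hxj]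
        · rw [← hg, hxj, hinv g hge]
    -- The sum of the `h n` is $k(z)+k(\bar z)=2k(z)$ on the plane.
    have hsum : k = (2⁻¹ : ℂ) • ∑ n ∈ S, h n := by
      ext x
      obtain ⟨z, hz1, hz2, hkz⟩ := hplane x
      have h1 : (∑ n ∈ S, h n) x = ∑ n ∈ S, h n x := by
        let evx : Test E R →ₗ[ℂ] ℂ :=
          { toFun := fun f => f x
            map_add' := fun _ _ => rfl
            map_smul' := fun _ _ => rfl }
        exact map_sum evx h S
      change k x = 2⁻¹ * (∑ n ∈ S, h n) x
      rw [h1, Finset.sum_congr rfl fun n _ => hx n x z hz1 hz2, Finset.sum_add_distrib, ← hS, ← hS]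
      change k x = 2⁻¹ * (k (i z) + k (i ((starRingEnd ℂ) z)))
      rw [hconj, hkz]
      ring
    rw [hsum]
    exact Submodule.smul_mem _ _ (sum_mem fun n _ => hh n)

theorem finiteVectors_le_test0 (b : OrthonormalBasis (Fin N) ℝ E) (hR : 0 ≤ R) :
    finiteVectors E R ≤ test0 b R := by
  borelize E
  intro f hf
  let V := Submodule.span ℂ (Set.range fun g => rotation E R g f)
  have : FiniteDimensional ℂ V := hf
  have hV (g : E ≃ₗᵢ[ℝ] E) : ∀ h ∈ V, rotation E R g h ∈ V := by
    have : V ≤ V.comap (rotation E R g) := Submodule.span_le.2 (by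
      rintro _ ⟨g', rfl⟩
      refine Submodule.subset_span ⟨g * g', ?_⟩
      simp)
    exact this
  have hfV : f ∈ V := Submodule.subset_span ⟨1, by simp⟩
  refine Submodule.span_le.2 ?_ (mem_span_zonal hV hfV)
  rintro k ⟨hk, y, hy⟩
  -- The origin is fixed by the whole group, so its kernel is radial; any other $y$ is normalized to
  -- a unit vector with the same stabilizer.
  rcases eq_or_ne y 0 with rfl | hy0
  · exact IsRadial.mem_test0 (fun g => hy g (map_zero g)) b
  · refine mem_test0_of_zonal b hR hV hk (norm_smul_inv_norm (𝕜 := ℝ) hy0) fun g hg => hy g ?_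
    rw [map_smul] at hg
    exact smul_right_injective E (by simpa using hy0) hg

end FiniteVectors

end OrthogonalFinite

end

theorem proposition4p6 {E : Type*} [NormedAddCommGroup E] [InnerProductSpace ℝ E]
    [FiniteDimensional ℝ E] {N : ℕ} (b : OrthonormalBasis (Fin N) ℝ E) (R : ℝ) (hR : 0 ≤ R) :
    (OrthogonalFinite.test0 b R : Set (OrthogonalFinite.Test E R)) =
        {f | OrthogonalFinite.IsFiniteVector (OrthogonalFinite.rotation E R) f} ∧
      Dense (OrthogonalFinite.test0 b R : Set (OrthogonalFinite.Test E R)) := by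
  refine ⟨Set.Subset.antisymm ?_ ?_, OrthogonalFinite.dense_test0 b hR⟩
  · exact OrthogonalFinite.test0_le_finiteVectors b
  · exact OrthogonalFinite.finiteVectors_le_test0 b hR
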